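/- For points $x_0,\dots,x_{N-1}\in[0,1)^d$ and a real number $p\ge 1$, the extreme $L_p$ discrepancy is $$L^{\mathrm{extr}}_{p,N}=\left(\int_{[0,1]^d}\int_{[0,1]^d,\,u\le v}\bigl|\,|\{n\in\{0,\dots,N-1\}:x_n\in[u,v)\}|-N\lambda([u,v))\,\bigr|^p\,du\,dv\right)^{1/p},$$ where $u\le v$ is meant coordinatewise, $[u,v)=[u_1,v_1)\times\dots\times[u_d,v_d)$, and $\lambda$ is Lebesgue measure, so $\lambda([u,v))=\prod_{j=1}^d(v_j-u_j)$. For an infinite sequence $S=(x_n)_{n\ge0}$ in $[0,1)^d$, $L^{\mathrm{extr}}_{p,N}(S)$ denotes the extreme $L_p$ discrepancy of its initial $N$ terms $x_0,\dots,x_{N-1}$. Theorem. For every dimension $d\ge 1$ and every real $p>1$ there exists a real $\alpha_{d,p}>0$, depending only on $d$ and $p$, with the following property: every infinite sequence $S$ in $[0,1)^d$ satisfies $$L^{\mathrm{extr}}_{p,N}(S)\ \ge\ \alpha_{d,p}\,(\log N)^{d/2}\qquad\text{for infinitely many }N\in\mathbb{N}.$$ For $d=1$ the same holds also for $p=1$.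 -/

import Mathlib

open MeasureTheory

namespace ExtremeDiscrepancy

/-- The half-open axis-parallel box `[u, v) = [u₁, v₁) × ⋯ × [u_d, v_d)`. -/
def box {d : ℕ} (u v : Fin d → ℝ) : Set (Fin d → ℝ) :=
  Set.univ.pi fun j => Set.Ico (u j) (v j)

/-- The counting function: the number of indices `n < N` with `P n ∈ B`
(points are counted with multiplicity). -/
noncomputable def count {d N : ℕ} (P : Fin N → Fin d → ℝ) (B : Set (Fin d → ℝ)) : ℕ :=
  Nat.card {n : Fin N // P n ∈ B}

/-- The local discrepancy `A_N(B, P) - N λ(B)` of `P` with respect to the test set `B`. -/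
noncomputable def localDisc {d N : ℕ} (P : Fin N → Fin d → ℝ) (B : Set (Fin d → ℝ)) : ℝ :=
  (count P B : ℝ) - (N : ℝ) * (volume : Measure (Fin d → ℝ)).real B

/-- The extreme `L_p` discrepancy of the points `P 0, …, P (N - 1)`: the `L_p` norm of the local
discrepancy of `[u, v)` over all `u, v ∈ [0,1]^d` with `u ≤ v` coordinatewise. -/
noncomputable def extremeLp {d N : ℕ} (p : ℝ) (P : Fin N → Fin d → ℝ) : ℝ :=
  (∫ v in Set.Icc (0 : Fin d → ℝ) 1, ∫ u in {u ∈ Set.Icc (0 : Fin d → ℝ) 1 | u ≤ v},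
    |localDisc P (box u v)| ^ p) ^ (1 / p)

/-- The extreme `L_p` discrepancy of the initial `N` terms of the infinite sequence `S`. -/
noncomputable def seqExtremeLp {d : ℕ} (p : ℝ) (S : ℕ → Fin d → ℝ) (N : ℕ) : ℝ :=
  extremeLp p (fun n : Fin N => S n)

end ExtremeDiscrepancy

namespace ExtremeDiscrepancy

open Finset

/-! ### Square function inequalities for Hilbert space valued dyadic martingales. -/

section MomentInequality

/-! Restrict the integral to `u ∈ [0,1/2)^d`, `v ∈ [1/2,1]^d`, and treat the number of terms `n <
2^K` as one more variable. For fixed `u` and a fixed offset of `v` inside a small cell, the local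
discrepancy becomes a function `D` on the grid `{0,…,2^K-1}^(d+1)`: a weighted count of `2^K` points
(time, position) minus a product of affine functions. The lower corner `u` enters only through 0-1
weights and affine constants. So a sequence in dimension `d` acts as a point set in dimension `d+1`,
for which Roth's method yields the exponent `d/2`. A lower bound for the grid average of `|D|^p`,
uniform in `u` and the offset (`GridLowerBound`), gives by pigeonhole an `n < 2^K` with extreme
discrepancy at least of order `K^(d/2)`; letting `K` grow gives infinitely many.

The grid bound is proved by duality. Take `J^d` shapes of dyadic boxes of one common volume, with
twice as many boxes of each shape as points. The Roth function `f_i` of a shape is minus the Haar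
function on the boxes free of points. An odd function ignores everything outside the box of a point,
so the count does not correlate with `f_i`, while the volume part contributes a constant on average
(`le_sum_rothFun_mul_gridDisc`). Hence `F = ∑ f_i` has average correlation at least of order `J^d`
with `D`.

For `p > 1`, each index of `F` is a martingale index, so iterating the square function inequality
(`exists_multi_moment_le`) gives `‖F‖_q ≲ J^(d/2)`, and Young's inequality concludes. For `p = d =
1` the test function must be bounded: Halász's product `Im ∏ (1 + i t f_l)` with `t = J^(-1/2)` has
linear part `t F`, and its other terms correlate little with `D`. -/

lemma abs_add_pow_sub_sub_pow_le {A B S : ℝ} (h1 : |A + B| ≤ S) (h2 : |A - B| ≤ S) (m : ℕ) :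
    |(A + B) ^ (m + 1) - (A - B) ^ (m + 1)| ≤ 2 * (m + 1) * |B| * S ^ m := by
  have hS : 0 ≤ S := (abs_nonneg _).trans h1
  induction m with
  | zero =>
    have : A + B - (A - B) = 2 * B := by ring
    simp [this, abs_mul]
  | succ m ih =>
    have e : (A + B) ^ (m + 1 + 1) - (A - B) ^ (m + 1 + 1)
        = (A + B) * ((A + B) ^ (m + 1) - (A - B) ^ (m + 1)) + 2 * B * (A - B) ^ (m + 1) := by ring
    rw [e]
    calc _ ≤ |A + B| * |(A + B) ^ (m + 1) - (A - B) ^ (m + 1)| + 2 * |B| * |A - B| ^ (m + 1) := by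
          refine (abs_add_le _ _).trans (le_of_eq ?_)
          simp [abs_mul, abs_pow]
      _ ≤ S * (2 * (m + 1) * |B| * S ^ m) + 2 * |B| * S ^ (m + 1) := by gcongr
      _ = _ := by push_cast; ring

variable {E : Type} [NormedAddCommGroup E] [InnerProductSpace ℝ E]

/-- This is used with `P = ‖u‖`, `Q = ‖w‖`, `B = 2⟪u,w⟫`. Terms of first order in `B` cancel in the
symmetric sum, so the excess over `2 P^(2(m+1))` carries a factor `Q²`. -/
lemma norm_add_pow_add_norm_sub_pow_le (m : ℕ) : ∃ C : ℝ, 0 ≤ C ∧ ∀ P Q B : ℝ, 0 ≤ P → 0 ≤ Q →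
    |B| ≤ 2 * P * Q → (P ^ 2 + Q ^ 2 + B) ^ (m + 1) + (P ^ 2 + Q ^ 2 - B) ^ (m + 1)
      ≤ 2 * (P ^ 2) ^ (m + 1) + C * Q ^ 2 * ((P + Q) ^ 2) ^ m := by
  induction m with
  | zero => exact ⟨2, by norm_num, fun P Q B _ _ _ => by simp; linarith⟩
  | succ m ih =>
    obtain ⟨C, hC, h⟩ := ih
    refine ⟨C + 8 * (m + 1) + 2, by positivity, fun P Q B hP hQ hB => ?_⟩
    have h' := h P Q B hP hQ hB
    obtain ⟨hB1, hB2⟩ := abs_le.1 hB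
    set A := P ^ 2 + Q ^ 2 with hA
    set S := (P + Q) ^ 2 with hS
    have hAP : 0 ≤ A := by positivity
    have hS0 : 0 ≤ S := by positivity
    have hPS : P ^ 2 ≤ S := by rw [hS]; gcongr; linarith
    have hSA : S = A + 2 * P * Q := by rw [hS, hA]; ring
    have h1 : |A + B| ≤ S := by rw [abs_le]; constructor <;> nlinarith
    have h2 : |A - B| ≤ S := by rw [abs_le]; constructor <;> nlinarith
    have hb := abs_add_pow_sub_sub_pow_le h1 h2 m
    have ha : (A + B) ^ (m + 1) + (A - B) ^ (m + 1) ≤ 2 * S ^ (m + 1) := by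
      have e1 := pow_le_pow_left₀ (abs_nonneg _) h1 (m + 1)
      have e2 := pow_le_pow_left₀ (abs_nonneg _) h2 (m + 1)
      rw [← abs_pow] at e1 e2
      linarith [le_abs_self ((A + B) ^ (m + 1)), le_abs_self ((A - B) ^ (m + 1))]
    have hBB : B * ((A + B) ^ (m + 1) - (A - B) ^ (m + 1)) ≤ 8 * (m + 1) * Q ^ 2 * S ^ (m + 1) := by
      calc _ ≤ |B| * |(A + B) ^ (m + 1) - (A - B) ^ (m + 1)| := by
            rw [← abs_mul]; exact le_abs_self _
        _ ≤ |B| * (2 * (m + 1) * |B| * S ^ m) := by gcongr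
        _ = 2 * (m + 1) * S ^ m * |B| ^ 2 := by ring
        _ ≤ 2 * (m + 1) * S ^ m * (2 * P * Q) ^ 2 := by gcongr
        _ = 8 * (m + 1) * Q ^ 2 * (S ^ m * P ^ 2) := by ring
        _ ≤ 8 * (m + 1) * Q ^ 2 * (S ^ m * S) := by gcongr
        _ = _ := by ring
    calc (A + B) ^ (m + 1 + 1) + (A - B) ^ (m + 1 + 1)
        = P ^ 2 * ((A + B) ^ (m + 1) + (A - B) ^ (m + 1))
          + Q ^ 2 * ((A + B) ^ (m + 1) + (A - B) ^ (m + 1))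
          + B * ((A + B) ^ (m + 1) - (A - B) ^ (m + 1)) := by rw [hA]; ring
      _ ≤ P ^ 2 * (2 * (P ^ 2) ^ (m + 1) + C * Q ^ 2 * S ^ m) + Q ^ 2 * (2 * S ^ (m + 1))
          + 8 * (m + 1) * Q ^ 2 * S ^ (m + 1) := by gcongr
      _ = 2 * (P ^ 2) ^ (m + 1 + 1) + C * Q ^ 2 * S ^ m * P ^ 2
          + (8 * (m + 1) + 2) * Q ^ 2 * S ^ (m + 1) := by ring
      _ ≤ 2 * (P ^ 2) ^ (m + 1 + 1) + C * Q ^ 2 * S ^ m * S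
          + (8 * (m + 1) + 2) * Q ^ 2 * S ^ (m + 1) := by gcongr
      _ = _ := by ring

/-- Uniform smoothness of a Hilbert space, for even powers of the norm. -/
lemma exists_norm_pow_le (m : ℕ) : ∃ C : ℝ, 0 ≤ C ∧
    ∀ (E : Type) [NormedAddCommGroup E] [InnerProductSpace ℝ E] (u w : E),
    (‖u + w‖ ^ 2) ^ (m + 1) + (‖u - w‖ ^ 2) ^ (m + 1)
      ≤ 2 * (‖u‖ ^ 2) ^ (m + 1) + C * ‖w‖ ^ 2 * ((‖u‖ ^ 2) ^ m + (‖w‖ ^ 2) ^ m) := by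
  obtain ⟨C, hC, h⟩ := norm_add_pow_add_norm_sub_pow_le m
  refine ⟨C * 4 ^ m, by positivity, fun E _ _ u w => ?_⟩
  have key := h ‖u‖ ‖w‖ (2 * inner ℝ u w) (norm_nonneg _) (norm_nonneg _) (by
    rw [abs_mul, abs_two, mul_assoc]
    gcongr
    exact abs_real_inner_le_norm u w)
  have e1 : ‖u + w‖ ^ 2 = ‖u‖ ^ 2 + ‖w‖ ^ 2 + 2 * inner ℝ u w := by
    rw [norm_add_sq_real]; ring
  have e2 : ‖u - w‖ ^ 2 = ‖u‖ ^ 2 + ‖w‖ ^ 2 - 2 * inner ℝ u w := by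
    rw [norm_sub_sq_real]; ring
  rw [e1, e2]
  refine key.trans ?_
  have : ((‖u‖ + ‖w‖) ^ 2) ^ m ≤ 4 ^ m * ((‖u‖ ^ 2) ^ m + (‖w‖ ^ 2) ^ m) := by
    rcases le_total ‖u‖ ‖w‖ with hl | hl
    · calc ((‖u‖ + ‖w‖) ^ 2) ^ m ≤ ((‖w‖ + ‖w‖) ^ 2) ^ m := by gcongr
        _ = 4 ^ m * (0 + (‖w‖ ^ 2) ^ m) := by rw [zero_add, ← mul_pow]; ring
        _ ≤ _ := by gcongr; positivity
    · calc ((‖u‖ + ‖w‖) ^ 2) ^ m ≤ ((‖u‖ + ‖u‖) ^ 2) ^ m := by gcongr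
        _ = 4 ^ m * ((‖u‖ ^ 2) ^ m + 0) := by rw [add_zero, ← mul_pow]; ring
        _ ≤ _ := by gcongr; positivity
  calc _ ≤ 2 * (‖u‖ ^ 2) ^ (m + 1)
        + C * ‖w‖ ^ 2 * (4 ^ m * ((‖u‖ ^ 2) ^ m + (‖w‖ ^ 2) ^ m)) := by gcongr
    _ = _ := by ring

/-- Convexity together with the parallelogram law; it makes even powers of the norm of a dyadic
martingale a submartingale. -/
lemma two_mul_norm_pow_le (u w : E) (m : ℕ) :
    2 * (‖u‖ ^ 2) ^ m ≤ (‖u + w‖ ^ 2) ^ m + (‖u - w‖ ^ 2) ^ m := by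
  rcases m with _ | m
  · norm_num
  have h := add_pow_le (sq_nonneg ‖u + w‖) (sq_nonneg ‖u - w‖) (m + 1)
  have e : ‖u + w‖ ^ 2 + ‖u - w‖ ^ 2 = 2 * (‖u‖ ^ 2 + ‖w‖ ^ 2) := by
    rw [norm_add_sq_real, norm_sub_sq_real]; ring
  rw [e, mul_pow, Nat.add_sub_cancel, pow_succ, mul_assoc] at h
  have h2 := le_of_mul_le_mul_left h (by positivity)
  refine le_trans ?_ h2
  gcongr
  nlinarith [sq_nonneg ‖w‖]

variable {X : Type*} [Fintype X]

lemma sum_eq_half_sum_add (σ : Equiv.Perm X) (g : X → ℝ) :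
    ∑ x, g x = ∑ x, (g x + g (σ x)) / 2 := by
  rw [← Finset.sum_div, Finset.sum_add_distrib, Equiv.sum_comp σ g]; ring

/-- The square function inequality for Hilbert space valued dyadic martingale differences, at even
exponents. The reflection `σ s` flips the sign of the `s`-th difference and fixes the earlier
ones. -/
theorem exists_moment_le (m : ℕ) : ∃ C : ℝ, 0 ≤ C ∧
    ∀ (E : Type) [NormedAddCommGroup E] [InnerProductSpace ℝ E] (X : Type) [Fintype X] (J : ℕ)
      (σ : ℕ → Equiv.Perm X) (D : ℕ → X → E), (∀ t < J, ∀ x, D t (σ t x) = -D t x) →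
      (∀ s < J, ∀ t < s, ∀ x, D t (σ s x) = D t x) →
      ∑ x, (‖∑ t ∈ range J, D t x‖ ^ 2) ^ (m + 1)
        ≤ C * ∑ x, (∑ t ∈ range J, ‖D t x‖ ^ 2) ^ (m + 1) := by
  obtain ⟨C, hC, hsm⟩ := exists_norm_pow_le m
  refine ⟨C + C * C ^ m, by positivity, ?_⟩
  intro E _ _ X _ J σ D hodd hinv
  set M : ℕ → X → E := fun k x => ∑ t ∈ range k, D t x with hM
  have hMs : ∀ k x, M (k + 1) x = M k x + D k x := fun k x => sum_range_succ _ _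
  have hMinv : ∀ k < J, ∀ x, M k (σ k x) = M k x := fun k hk x =>
    sum_congr rfl fun t ht => hinv k hk t (mem_range.1 ht) x
  have hM' : ∀ k < J, ∀ x, M (k + 1) (σ k x) = M k x - D k x := fun k hk x => by
    rw [hMs, hMinv k hk, hodd k hk, sub_eq_add_neg]
  have stepA : ∀ k < J, ∑ x, (‖M (k + 1) x‖ ^ 2) ^ (m + 1) ≤ ∑ x, (‖M k x‖ ^ 2) ^ (m + 1)
      + C / 2 * ∑ x, ‖D k x‖ ^ 2 * ((‖M k x‖ ^ 2) ^ m + (‖D k x‖ ^ 2) ^ m) := by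
    intro k hk
    rw [sum_eq_half_sum_add (σ k), mul_sum, ← sum_add_distrib]
    refine sum_le_sum fun x _ => ?_
    rw [hM' k hk, hMs]
    have := hsm E (M k x) (D k x)
    linarith
  -- Submartingale property of `‖M l‖^(2m)`; the weight `‖D k‖²` is invariant under the reflections
  -- `σ l`, `l ≥ k`.
  have stepB : ∀ k < J, ∀ l, k ≤ l → l ≤ J → ∑ x, ‖D k x‖ ^ 2 * (‖M k x‖ ^ 2) ^ m
      ≤ ∑ x, ‖D k x‖ ^ 2 * (‖M l x‖ ^ 2) ^ m := by
    intro k hk l hkl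
    induction l, hkl using Nat.le_induction with
    | base => exact fun _ => le_rfl
    | succ l hkl ih =>
      intro hlJ
      refine (ih (by omega)).trans ?_
      rw [sum_eq_half_sum_add (σ l) (fun x => ‖D k x‖ ^ 2 * (‖M (l + 1) x‖ ^ 2) ^ m)]
      refine sum_le_sum fun x _ => ?_
      have hD : ‖D k (σ l x)‖ = ‖D k x‖ := by
        rcases hkl.eq_or_lt with rfl | h
        · rw [hodd k hk, norm_neg]
        · rw [hinv l (by omega) k h]
      rw [hD, hM' l (by omega), hMs, ← mul_add, mul_div_assoc]
      gcongr
      linarith [two_mul_norm_pow_le (M l x) (D l x) m]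
  set T : X → ℝ := fun x => ∑ t ∈ range J, ‖D t x‖ ^ 2 with hT
  have hDT : ∀ k < J, ∀ x, ‖D k x‖ ^ 2 ≤ T x := fun k hk x =>
    single_le_sum (f := fun t => ‖D t x‖ ^ 2) (fun _ _ => by positivity) (mem_range.2 hk)
  have hT0 : ∀ x, 0 ≤ T x := fun x => sum_nonneg fun _ _ => by positivity
  have tele : ∀ k ≤ J, ∑ x, (‖M k x‖ ^ 2) ^ (m + 1)
      ≤ C / 2 * ∑ x, (∑ t ∈ range k, ‖D t x‖ ^ 2) * ((‖M J x‖ ^ 2) ^ m + T x ^ m) := by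
    intro k
    induction k with
    | zero => intro _; simp [hM]
    | succ k ih =>
      intro hk
      refine (stepA k hk).trans ?_
      have h1 := ih (by omega)
      have h2 : ∑ x, ‖D k x‖ ^ 2 * ((‖M k x‖ ^ 2) ^ m + (‖D k x‖ ^ 2) ^ m)
          ≤ ∑ x, ‖D k x‖ ^ 2 * ((‖M J x‖ ^ 2) ^ m + T x ^ m) := by
        simp only [mul_add, sum_add_distrib]
        refine add_le_add (stepB k hk J (by omega) le_rfl) (sum_le_sum fun x _ => ?_)
        have := hDT k hk x
        gcongr
      have h3 := mul_le_mul_of_nonneg_left h2 (by positivity : 0 ≤ C / 2)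
      refine (add_le_add h1 h3).trans (le_of_eq ?_)
      rw [← mul_add, ← sum_add_distrib]
      simp only [sum_range_succ, add_mul]
  -- Half of the final moment is split off so that it can be absorbed on the left; the cases compare
  -- `C * T x` with `‖M J x‖²`.
  have young : ∀ x, C / 2 * (T x * ((‖M J x‖ ^ 2) ^ m + T x ^ m))
      ≤ (‖M J x‖ ^ 2) ^ (m + 1) / 2 + (C / 2 + C / 2 * C ^ m) * T x ^ (m + 1) := by
    intro x
    have ht := hT0 x
    set y := ‖M J x‖ ^ 2
    have hy : 0 ≤ y := by positivity
    have : C / 2 * T x * y ^ m ≤ y ^ (m + 1) / 2 + C / 2 * C ^ m * T x ^ (m + 1) := by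
      rcases le_total (C * T x) y with h | h
      · have h1 : C * T x * y ^ m ≤ y * y ^ m := by gcongr
        have h2 : 0 ≤ C / 2 * C ^ m * T x ^ (m + 1) := by positivity
        rw [pow_succ']; linarith
      · have h1 : C * T x * y ^ m ≤ C * T x * (C * T x) ^ m := by gcongr
        have h2 : 0 ≤ y ^ (m + 1) / 2 := by positivity
        have h3 : C * T x * (C * T x) ^ m = C * C ^ m * T x ^ (m + 1) := by rw [mul_pow]; ring
        linarith
    calc _ = C / 2 * T x * y ^ m + C / 2 * T x ^ (m + 1) := by ring
      _ ≤ _ := by linarith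
  have h := tele J le_rfl
  rw [mul_sum] at h
  have h2 := h.trans (sum_le_sum fun x _ => young x)
  rw [sum_add_distrib, ← sum_div, ← mul_sum] at h2
  change ∑ x, (‖M J x‖ ^ 2) ^ (m + 1) ≤ _ * ∑ x, T x ^ (m + 1)
  linarith

/-- The iterated square function inequality for families indexed by several scales. -/
theorem exists_multi_moment_le (m d : ℕ) : ∃ C : ℝ, 0 ≤ C ∧
    ∀ (E : Type) [NormedAddCommGroup E] [InnerProductSpace ℝ E] (X : Type) [Fintype X] (J : ℕ)
      (σ : Fin d → Fin J → Equiv.Perm X) (f : (Fin d → Fin J) → X → E),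
      (∀ i j x, f i (σ j (i j) x) = -f i x) →
      (∀ i j s x, i j < s → f i (σ j s x) = f i x) →
      ∑ x, (‖∑ i, f i x‖ ^ 2) ^ (m + 1) ≤ C * ∑ x, (∑ i, ‖f i x‖ ^ 2) ^ (m + 1) := by
  induction d with
  | zero =>
    refine ⟨1, zero_le_one, fun E _ _ X _ J σ f _ _ => ?_⟩
    simp
  | succ d ih =>
    obtain ⟨C₁, hC₁, h₁⟩ := exists_moment_le m
    obtain ⟨C₂, hC₂, h₂⟩ := ih
    refine ⟨C₁ * C₂, by positivity, fun E _ _ X _ J σ f hodd hinv => ?_⟩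
    have split : ∀ {A : Type} [AddCommMonoid A] (g : (Fin (d + 1) → Fin J) → A),
        ∑ i, g i = ∑ k, ∑ i, g (Fin.cons k i) := fun g => by
      rw [← Fintype.sum_prod_type' (fun k i => g (Fin.cons k i))]
      exact (Equiv.sum_comp (Fin.consEquiv fun _ => Fin J) g).symm
    set D : Fin J → X → E := fun k x => ∑ i, f (Fin.cons k i) x with hD
    have one := h₁ E X J (fun t => if h : t < J then σ 0 ⟨t, h⟩ else 1)
      (fun t x => if h : t < J then D ⟨t, h⟩ x else 0)
      (fun t ht x => by
        simp only [ht, dite_true, hD]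
        rw [← sum_neg_distrib]
        exact sum_congr rfl fun i _ => by
          simpa using hodd (Fin.cons ⟨t, ht⟩ i) 0 x)
      (fun s hs t hts x => by
        have ht : t < J := hts.trans hs
        simp only [ht, hs, dite_true, hD]
        exact sum_congr rfl fun i _ => hinv (Fin.cons ⟨t, ht⟩ i) 0 ⟨s, hs⟩ x (by simpa using hts))
    simp only [Finset.sum_range, Fin.is_lt, dite_true, Fin.eta] at one
    -- The square function of the first index is the norm of one `ℓ²`-valued sum over the remaining
    -- indices. This is why the inequality is needed for all Hilbert spaces with one constant.
    have two := h₂ (PiLp 2 fun _ : Fin J => E) X J (fun j => σ j.succ)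
      (fun i x => WithLp.toLp 2 fun k => f (Fin.cons k i) x)
      (fun i j x => by
        rw [← WithLp.toLp_neg]
        congr 1
        ext k
        simpa using hodd (Fin.cons k i) j.succ x)
      (fun i j s x hs => by
        congr 1
        ext k
        exact hinv (Fin.cons k i) j.succ s x (by simpa using hs))
    simp only [PiLp.norm_sq_eq_of_L2, WithLp.ofLp_sum, Finset.sum_apply] at two
    have e₁ : ∀ x, ∑ i, f i x = ∑ k, D k x := fun x => split _
    have e₂ : ∀ x, ∑ i, ‖f i x‖ ^ 2 = ∑ k, ∑ i, ‖f (Fin.cons k i) x‖ ^ 2 := fun x => split _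
    simp only [e₁, e₂]
    refine one.trans ?_
    rw [mul_assoc]
    refine mul_le_mul_of_nonneg_left ?_ hC₁
    refine two.trans (le_of_eq ?_)
    congr 1
    exact sum_congr rfl fun x _ => by rw [sum_comm]

end MomentInequality

/-! ### Binary digit reflections and functions odd under them. -/

section Reflections

/-- Reverse the `s`-th binary digit. -/
def flipNat (s a : ℕ) : ℕ := if a / 2 ^ s % 2 = 0 then a + 2 ^ s else a - 2 ^ s

/-- The Rademacher sign of the `s`-th binary digit. -/
def rad (s a : ℕ) : ℝ := if a / 2 ^ s % 2 = 0 then -1 else 1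

lemma flipNat_of_even {s a : ℕ} (h : a / 2 ^ s % 2 = 0) : flipNat s a = a + 2 ^ s := if_pos h

lemma flipNat_of_odd {s a : ℕ} (h : a / 2 ^ s % 2 ≠ 0) : flipNat s a = a - 2 ^ s := if_neg h

lemma two_pow_le_of_odd {s a : ℕ} (h : a / 2 ^ s % 2 ≠ 0) : 2 ^ s ≤ a := by
  by_contra hlt
  rw [Nat.div_eq_of_lt (not_le.1 hlt)] at h
  simp at h

lemma flipNat_div_of_even {s a : ℕ} (h : a / 2 ^ s % 2 = 0) :
    flipNat s a / 2 ^ s = a / 2 ^ s + 1 := by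
  rw [flipNat_of_even h, Nat.add_div_right _ (by positivity)]

lemma flipNat_div_of_odd {s a : ℕ} (h : a / 2 ^ s % 2 ≠ 0) :
    flipNat s a / 2 ^ s = a / 2 ^ s - 1 := by
  obtain ⟨b, rfl⟩ := Nat.exists_eq_add_of_le' (two_pow_le_of_odd h)
  rw [flipNat_of_odd h, Nat.add_sub_cancel, Nat.add_div_right _ (by positivity)]
  simp

lemma flipNat_flipNat (s a : ℕ) : flipNat s (flipNat s a) = a := by
  by_cases h : a / 2 ^ s % 2 = 0
  · have h' : flipNat s a / 2 ^ s % 2 ≠ 0 := by rw [flipNat_div_of_even h]; omega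
    rw [flipNat_of_odd h', flipNat_of_even h, Nat.add_sub_cancel]
  · have h' : flipNat s a / 2 ^ s % 2 = 0 := by rw [flipNat_div_of_odd h]; omega
    rw [flipNat_of_even h', flipNat_of_odd h, Nat.sub_add_cancel (two_pow_le_of_odd h)]

lemma rad_flipNat (s a : ℕ) : rad s (flipNat s a) = -rad s a := by
  unfold rad
  by_cases h : a / 2 ^ s % 2 = 0
  · rw [flipNat_div_of_even h, if_pos h, if_neg (by omega), neg_neg]
  · rw [flipNat_div_of_odd h, if_neg h, if_pos (by omega)]

lemma rad_mul_rad (s a : ℕ) : rad s a * rad s a = 1 := by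
  unfold rad; split_ifs <;> norm_num

lemma abs_rad (s a : ℕ) : |rad s a| = 1 := by
  unfold rad; split_ifs <;> norm_num

lemma sub_flipNat (s a : ℕ) : (a : ℝ) - flipNat s a = rad s a * 2 ^ s := by
  unfold rad
  by_cases h : a / 2 ^ s % 2 = 0
  · rw [flipNat_of_even h, if_pos h]; push_cast; ring
  · rw [flipNat_of_odd h, if_neg h, Nat.cast_sub (two_pow_le_of_odd h)]; push_cast; ring

lemma flipNat_div_of_lt {s t : ℕ} (h : s < t) (a : ℕ) : flipNat s a / 2 ^ t = a / 2 ^ t := by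
  obtain ⟨k, rfl⟩ := Nat.exists_eq_add_of_lt h
  have key : flipNat s a / 2 ^ s / 2 = a / 2 ^ s / 2 := by
    by_cases hp : a / 2 ^ s % 2 = 0
    · rw [flipNat_div_of_even hp]
      generalize a / 2 ^ s = q at hp ⊢
      omega
    · rw [flipNat_div_of_odd hp]
      generalize a / 2 ^ s = q at hp ⊢
      omega
  rw [show s + k + 1 = s + (1 + k) by ring, pow_add, pow_add, ← Nat.div_div_eq_div_mul,
    ← Nat.div_div_eq_div_mul, ← Nat.div_div_eq_div_mul a, ← Nat.div_div_eq_div_mul, pow_one, key]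

lemma rad_flipNat_of_lt {s t : ℕ} (h : s < t) (a : ℕ) : rad t (flipNat s a) = rad t a := by
  unfold rad; rw [flipNat_div_of_lt h]

/-- Flipping digit `s` stays inside a dyadic interval of length `2^(s+1)`, so comparison with a `y`
outside that interval is unaffected. -/
lemma le_flipNat_iff {s a y : ℕ} (h : y / 2 ^ (s + 1) ≠ a / 2 ^ (s + 1)) :
    y ≤ flipNat s a ↔ y ≤ a := by
  have key : ∀ b, b / 2 ^ (s + 1) = a / 2 ^ (s + 1) →
      (y ≤ b ↔ y / 2 ^ (s + 1) < a / 2 ^ (s + 1)) := by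
    intro b hb
    constructor
    · intro hy
      exact lt_of_le_of_ne ((Nat.div_le_div_right hy).trans hb.le) h
    · intro hy
      rw [← hb] at hy
      exact (Nat.lt_of_div_lt_div hy).le
  rw [key _ (flipNat_div_of_lt s.lt_succ_self a), key a rfl]

lemma flipNat_lt {s K a : ℕ} (hs : s < K) (ha : a < 2 ^ K) : flipNat s a < 2 ^ K := by
  have h := flipNat_div_of_lt hs a
  rw [Nat.div_eq_of_lt ha] at h
  exact (Nat.div_eq_zero_iff_lt (by positivity)).1 h

/-- Reverse the `s`-th binary digit of a number with `K` digits. -/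
def flipFin (K s : ℕ) (a : Fin (2 ^ K)) : Fin (2 ^ K) :=
  if h : s < K then ⟨flipNat s a, flipNat_lt h a.2⟩ else a

lemma coe_flipFin {K s : ℕ} (hs : s < K) (a : Fin (2 ^ K)) :
    (flipFin K s a : ℕ) = flipNat s a := by
  simp [flipFin, hs]

lemma flipFin_flipFin (K s : ℕ) (a : Fin (2 ^ K)) : flipFin K s (flipFin K s a) = a := by
  by_cases hs : s < K
  · ext; rw [coe_flipFin hs, coe_flipFin hs, flipNat_flipNat]
  · simp [flipFin, hs]

variable {ι : Type} [DecidableEq ι]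

/-- Reverse the `s`-th binary digit of the `j`-th coordinate. -/
def reflect (K : ℕ) (j : ι) (s : ℕ) : Equiv.Perm (ι → Fin (2 ^ K)) :=
  Function.Involutive.toPerm (fun a => Function.update a j (flipFin K s (a j))) fun a => by
    simp [flipFin_flipFin]

lemma reflect_apply_self (K : ℕ) (j : ι) (s : ℕ) (a : ι → Fin (2 ^ K)) :
    reflect K j s a j = flipFin K s (a j) :=
  Function.update_self ..

lemma reflect_apply_of_ne (K : ℕ) {j l : ι} (h : l ≠ j) (s : ℕ) (a : ι → Fin (2 ^ K)) :
    reflect K j s a l = a l :=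
  Function.update_of_ne h ..

variable [Fintype ι]

lemma sum_eq_zero_of_odd {X : Type*} [Fintype X] (σ : Equiv.Perm X) (g : X → ℝ)
    (h : ∀ x, g (σ x) = -g x) : ∑ x, g x = 0 := by
  rw [sum_eq_half_sum_add σ]
  simp [h]

/-- Pairing a function that is odd in every coordinate with a tensor product only sees each factor
modulo reflection invariant functions. -/
theorem sum_mul_prod_eq_of_odd {K : ℕ} {s : ι → ℕ} {H : (ι → Fin (2 ^ K)) → ℝ}
    (hH : ∀ j a, H (reflect K j (s j) a) = -H a) (g g' : ι → Fin (2 ^ K) → ℝ)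
    (hg : ∀ j a, g j (flipFin K (s j) a) - g' j (flipFin K (s j) a) = g j a - g' j a) :
    ∑ a, H a * ∏ j, g j (a j) = ∑ a, H a * ∏ j, g' j (a j) := by
  -- Exchange the factors one coordinate at a time; each exchange changes the sum by a sum that is
  -- odd under a single reflection.
  have key : ∀ S : Finset ι, ∑ a, H a * ∏ j, g j (a j)
      = ∑ a, H a * ∏ j, (if j ∈ S then g' j (a j) else g j (a j)) := by
    intro S
    induction S using Finset.induction with
    | empty => simp
    | insert l S hl ih =>
      rw [ih, ← sub_eq_zero, ← sum_sub_distrib]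
      set R : (ι → Fin (2 ^ K)) → ℝ := fun a =>
        ∏ j ∈ univ.erase l, (if j ∈ S then g' j (a j) else g j (a j)) with hR
      have e : ∀ a, H a * ∏ j, (if j ∈ S then g' j (a j) else g j (a j))
          - H a * ∏ j, (if j ∈ insert l S then g' j (a j) else g j (a j))
          = H a * ((g l (a l) - g' l (a l)) * R a) := by
        intro a
        rw [← mul_prod_erase univ _ (mem_univ l),
          ← mul_prod_erase univ (fun j => if j ∈ insert l S then g' j (a j) else g j (a j))
            (mem_univ l)]
        have : ∏ j ∈ univ.erase l, (if j ∈ insert l S then g' j (a j) else g j (a j)) = R a :=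
          prod_congr rfl fun j hj => by simp [ne_of_mem_erase hj]
        rw [this]
        simp only [hl, if_false, mem_insert_self, if_true]
        ring
      simp only [e]
      refine sum_eq_zero_of_odd (reflect K l (s l)) _ fun a => ?_
      have hRa : R (reflect K l (s l) a) = R a := prod_congr rfl fun j hj => by
        rw [reflect_apply_of_ne K (ne_of_mem_erase hj)]
      rw [hH, hRa, reflect_apply_self, hg]
      ring
  simpa using key univ

/-- The indicator that `a` lies in the dyadic box of side lengths `2 ^ (s j + 1)` around `y`. -/
def boxInd {K : ℕ} (s : ι → ℕ) (y : ι → ℕ) (a : ι → Fin (2 ^ K)) : ℝ :=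
  ∏ j, if y j / 2 ^ (s j + 1) = (a j : ℕ) / 2 ^ (s j + 1) then 1 else 0

/-- The indicator of `y ≤ a`. -/
def geInd {K : ℕ} (y : ι → ℕ) (a : ι → Fin (2 ^ K)) : ℝ :=
  ∏ j, if y j ≤ (a j : ℕ) then 1 else 0

lemma sum_mul_geInd {K : ℕ} {s : ι → ℕ} (hs : ∀ j, s j < K) {H : (ι → Fin (2 ^ K)) → ℝ}
    (hH : ∀ j a, H (reflect K j (s j) a) = -H a) (y : ι → ℕ) :
    ∑ a, H a * geInd y a = ∑ a, H a * (geInd y a * boxInd s y a) := by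
  simp only [geInd, boxInd, ← prod_mul_distrib]
  refine sum_mul_prod_eq_of_odd hH
    (fun j b => if y j ≤ (b : ℕ) then 1 else 0)
    (fun j b => (if y j ≤ (b : ℕ) then 1 else 0) *
      if y j / 2 ^ (s j + 1) = (b : ℕ) / 2 ^ (s j + 1) then 1 else 0) fun j b => ?_
  rw [coe_flipFin (hs j), flipNat_div_of_lt (s j).lt_succ_self]
  by_cases h : y j / 2 ^ (s j + 1) = (b : ℕ) / 2 ^ (s j + 1)
  · simp [h]
  · simp only [le_flipNat_iff h]

/-- Flipping digit `s` moves `a` by `±2^s`, so the odd part of `α + β a` is `β 2^s / 2` times the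
Rademacher sign. -/
lemma sum_mul_prod_affine {K : ℕ} {s : ι → ℕ} (hs : ∀ j, s j < K) {H : (ι → Fin (2 ^ K)) → ℝ}
    (hH : ∀ j a, H (reflect K j (s j) a) = -H a) (α β : ι → ℝ) :
    ∑ a, H a * ∏ j, (α j + β j * (a j : ℕ))
      = (∏ j, β j * 2 ^ s j / 2) * ∑ a, H a * ∏ j, rad (s j) (a j) := by
  rw [mul_sum]
  rw [sum_mul_prod_eq_of_odd hH (fun j b => α j + β j * (b : ℕ))
    (fun j b => β j * 2 ^ s j / 2 * rad (s j) b) fun j b => ?_]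
  · refine sum_congr rfl fun a _ => ?_
    rw [prod_mul_distrib]; ring
  · rw [coe_flipFin (hs j), rad_flipNat]
    have := sub_flipNat (s j) b
    linear_combination (-β j) * this

lemma boxInd_nonneg {κ : Type} [Fintype κ] {K : ℕ} (s y : κ → ℕ) (a : κ → Fin (2 ^ K)) : 0 ≤ boxInd s y a :=
  prod_nonneg fun j _ => by split_ifs <;> norm_num

lemma geInd_nonneg {κ : Type} [Fintype κ] {K : ℕ} (y : κ → ℕ) (a : κ → Fin (2 ^ K)) : 0 ≤ geInd y a :=
  prod_nonneg fun j _ => by split_ifs <;> norm_num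

lemma geInd_le_one {κ : Type} [Fintype κ] {K : ℕ} (y : κ → ℕ) (a : κ → Fin (2 ^ K)) : geInd y a ≤ 1 :=
  prod_le_one (fun j _ => by split_ifs <;> norm_num) fun j _ => by split_ifs <;> norm_num

lemma boxInd_reflect {K : ℕ} {s : ι → ℕ} (y : ι → ℕ) {j : ι} {t : ℕ} (ht : t ≤ s j)
    (hs : s j < K) (a : ι → Fin (2 ^ K)) : boxInd s y (reflect K j t a) = boxInd s y a := by
  refine prod_congr rfl fun l _ => ?_
  by_cases h : l = j
  · subst h
    rw [reflect_apply_self, coe_flipFin (ht.trans_lt hs), flipNat_div_of_lt (by omega)]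
  · rw [reflect_apply_of_ne K h]

lemma sum_boxInd_le (K : ℕ) (s y : ι → ℕ) :
    ∑ a : ι → Fin (2 ^ K), boxInd s y a ≤ ∏ j, (2 : ℝ) ^ (s j + 1) := by
  unfold boxInd
  rw [← Fintype.prod_sum (fun j (b : Fin (2 ^ K)) =>
    if y j / 2 ^ (s j + 1) = (b : ℕ) / 2 ^ (s j + 1) then (1 : ℝ) else 0)]
  refine prod_le_prod (fun j _ => sum_nonneg fun b _ => by split_ifs <;> norm_num) fun j _ => ?_
  rw [sum_boole]
  have hc : #{b : Fin (2 ^ K) | y j / 2 ^ (s j + 1) = (b : ℕ) / 2 ^ (s j + 1)}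
      ≤ #(Ico (y j / 2 ^ (s j + 1) * 2 ^ (s j + 1)) ((y j / 2 ^ (s j + 1) + 1) * 2 ^ (s j + 1))) := by
    refine card_le_card_of_injOn (fun b => (b : ℕ)) (fun b hb => ?_) fun b _ c _ h => Fin.ext h
    have hb' := (mem_filter.1 hb).2
    simp only [coe_Ico, Set.mem_Ico]
    rw [hb']
    exact ⟨Nat.div_mul_le_self _ _, by
      rw [mul_comm]; exact Nat.lt_mul_div_succ _ (by positivity)⟩
  rw [Nat.card_Ico, add_mul, one_mul, Nat.add_sub_cancel_left] at hc
  exact_mod_cast hc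

end Reflections

/-! ### Roth's auxiliary functions and their correlation with the discrepancy. -/

section RothFunctions

lemma boxInd_eq_zero_or_one {κ : Type} [Fintype κ] {K : ℕ} (s y : κ → ℕ) (a : κ → Fin (2 ^ K)) :
    boxInd s y a = 0 ∨ boxInd s y a = 1 := by
  by_cases h : ∀ j, y j / 2 ^ (s j + 1) = (a j : ℕ) / 2 ^ (s j + 1)
  · exact Or.inr (prod_eq_one fun j _ => if_pos (h j))
  · push Not at h
    obtain ⟨j, hj⟩ := h
    exact Or.inl (prod_eq_zero (mem_univ j) (if_neg hj))

/-- The discrepancy function of weighted points `y k` on a grid, with respect to the volume form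
`∏ j, (α j + β j * a j)`. -/
def gridDisc {κ : Type} [Fintype κ] {K M : ℕ} (c : Fin M → ℝ) (y : Fin M → κ → ℕ) (α β : κ → ℝ)
    (a : κ → Fin (2 ^ K)) : ℝ :=
  ∑ k, c k * geInd (y k) a - ∏ j, (α j + β j * (a j : ℕ))

/-- The indicator that the dyadic box of `a` contains none of the points. -/
def emptyInd {κ : Type} [Fintype κ] {K M : ℕ} (s : κ → ℕ) (y : Fin M → κ → ℕ)
    (a : κ → Fin (2 ^ K)) : ℝ :=
  ∏ k, (1 - boxInd s (y k) a)

lemma emptyInd_eq_zero_or_one {κ : Type} [Fintype κ] {K M : ℕ} (s : κ → ℕ) (y : Fin M → κ → ℕ)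
    (a : κ → Fin (2 ^ K)) : emptyInd s y a = 0 ∨ emptyInd s y a = 1 := by
  by_cases h : ∃ k, boxInd s (y k) a = 1
  · obtain ⟨k, hk⟩ := h
    exact Or.inl (prod_eq_zero (mem_univ k) (by rw [hk, sub_self]))
  · push Not at h
    refine Or.inr (prod_eq_one fun k _ => ?_)
    rw [(boxInd_eq_zero_or_one s (y k) a).resolve_right (h k), sub_zero]

lemma emptyInd_mul_boxInd {κ : Type} [Fintype κ] {K M : ℕ} (s : κ → ℕ) (y : Fin M → κ → ℕ)
    (k : Fin M) (a : κ → Fin (2 ^ K)) : emptyInd s y a * boxInd s (y k) a = 0 := by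
  rcases boxInd_eq_zero_or_one s (y k) a with h | h
  · rw [h, mul_zero]
  · rw [emptyInd, prod_eq_zero (mem_univ k) (by rw [h, sub_self]), zero_mul]

lemma one_sub_sum_le_emptyInd {κ : Type} [Fintype κ] {K M : ℕ} (s : κ → ℕ) (y : Fin M → κ → ℕ)
    (a : κ → Fin (2 ^ K)) : 1 - ∑ k, boxInd s (y k) a ≤ emptyInd s y a := by
  rcases emptyInd_eq_zero_or_one s y a with h | h
  · rw [h]
    obtain ⟨k, -, hk⟩ := prod_eq_zero_iff.1 h
    have := single_le_sum (f := fun k => boxInd s (y k) a) (fun k _ => boxInd_nonneg s (y k) a)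
      (mem_univ k)
    linarith
  · rw [h]
    have := sum_nonneg (fun (k : Fin M) (_ : k ∈ univ) => boxInd_nonneg s (y k) a)
    linarith

/-- Roth's auxiliary function at the scales `s`: minus the Haar functions of all empty boxes. -/
def rothFun {κ : Type} [Fintype κ] {K M : ℕ} (s : κ → ℕ) (y : Fin M → κ → ℕ)
    (a : κ → Fin (2 ^ K)) : ℝ :=
  -(∏ j, rad (s j) (a j)) * emptyInd s y a

lemma abs_rothFun_le {κ : Type} [Fintype κ] {K M : ℕ} (s : κ → ℕ) (y : Fin M → κ → ℕ)
    (a : κ → Fin (2 ^ K)) : |rothFun s y a| ≤ 1 := by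
  have h : |∏ j, rad (s j) (a j)| = 1 := by
    rw [abs_prod]; exact prod_eq_one fun j _ => abs_rad _ _
  rw [rothFun, abs_mul, abs_neg, h, one_mul]
  rcases emptyInd_eq_zero_or_one s y a with h | h <;> simp [h]

variable {ι : Type} [DecidableEq ι] [Fintype ι]

lemma emptyInd_reflect {K M : ℕ} {s : ι → ℕ} (y : Fin M → ι → ℕ) {j : ι} {t : ℕ} (ht : t ≤ s j)
    (hs : s j < K) (a : ι → Fin (2 ^ K)) : emptyInd s y (reflect K j t a) = emptyInd s y a := by
  simp only [emptyInd, boxInd_reflect _ ht hs]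

lemma rothFun_reflect_self {K M : ℕ} {s : ι → ℕ} (y : Fin M → ι → ℕ) {j : ι}
    (hs : s j < K) (a : ι → Fin (2 ^ K)) :
    rothFun s y (reflect K j (s j) a) = -rothFun s y a := by
  have h : ∏ l, rad (s l) (reflect K j (s j) a l) = -∏ l, rad (s l) (a l) := by
    rw [← mul_prod_erase univ _ (mem_univ j),
      ← mul_prod_erase univ (fun l => rad (s l) (a l)) (mem_univ j), reflect_apply_self,
      coe_flipFin hs, rad_flipNat, neg_mul]
    congr 2
    exact prod_congr rfl fun l hl => by rw [reflect_apply_of_ne K (ne_of_mem_erase hl)]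
  rw [rothFun, rothFun, emptyInd_reflect y le_rfl hs, h]
  ring

lemma rothFun_reflect_of_lt {K M : ℕ} {s : ι → ℕ} (y : Fin M → ι → ℕ) {j : ι} {t : ℕ}
    (ht : t < s j) (hs : s j < K) (a : ι → Fin (2 ^ K)) :
    rothFun s y (reflect K j t a) = rothFun s y a := by
  have h : ∏ l, rad (s l) (reflect K j t a l) = ∏ l, rad (s l) (a l) := by
    refine prod_congr rfl fun l _ => ?_
    by_cases hl : l = j
    · subst hl
      rw [reflect_apply_self, coe_flipFin (ht.trans hs), rad_flipNat_of_lt ht]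
    · rw [reflect_apply_of_ne K hl]
  rw [rothFun, rothFun, emptyInd_reflect y ht.le hs, h]

lemma sum_mul_gridDisc {K M : ℕ} {s : ι → ℕ} (hs : ∀ j, s j < K) {H : (ι → Fin (2 ^ K)) → ℝ}
    (hH : ∀ j a, H (reflect K j (s j) a) = -H a) (c : Fin M → ℝ) (y : Fin M → ι → ℕ)
    (α β : ι → ℝ) :
    ∑ a, H a * gridDisc c y α β a
      = ∑ k, c k * ∑ a, H a * (geInd (y k) a * boxInd s (y k) a)
        - (∏ j, β j * 2 ^ s j / 2) * ∑ a, H a * ∏ j, rad (s j) (a j) := by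
  rw [← sum_mul_prod_affine hs hH α β]
  simp only [gridDisc, mul_sub, sum_sub_distrib, mul_sum]
  congr 1
  rw [sum_comm]
  refine sum_congr rfl fun k _ => ?_
  rw [← mul_sum, ← sum_mul_geInd hs hH, mul_sum]
  exact sum_congr rfl fun a _ => by ring

/-- Roth functions correlate with the discrepancy function. -/
lemma le_sum_rothFun_mul_gridDisc {K M : ℕ} {s : ι → ℕ} (hs : ∀ j, s j < K) (c : Fin M → ℝ)
    (y : Fin M → ι → ℕ) (α β : ι → ℝ) (hβ : 0 ≤ ∏ j, β j * 2 ^ s j / 2) :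
    (∏ j, β j * 2 ^ s j / 2) *
        (Fintype.card (ι → Fin (2 ^ K)) - M * ∏ j, (2 : ℝ) ^ (s j + 1))
      ≤ ∑ a : ι → Fin (2 ^ K), rothFun s y a * gridDisc c y α β a := by
  rw [sum_mul_gridDisc hs fun j a => rothFun_reflect_self y (hs j) a]
  have h1 : ∀ k (a : ι → Fin (2 ^ K)), rothFun s y a * (geInd (y k) a * boxInd s (y k) a) = 0 := fun k a => by
    rw [rothFun]
    linear_combination (-(∏ j, rad (s j) (a j)) * geInd (y k) a) * emptyInd_mul_boxInd s y k a
  have h2 : ∀ a : ι → Fin (2 ^ K), rothFun s y a * ∏ j, rad (s j) (a j) = -emptyInd s y a := by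
    intro a
    have : (∏ j, rad (s j) (a j)) * ∏ j, rad (s j) (a j) = 1 := by
      rw [← prod_mul_distrib]; exact prod_eq_one fun j _ => rad_mul_rad _ _
    rw [rothFun]
    linear_combination (-emptyInd s y a) * this
  simp only [h1, h2, sum_const_zero, mul_zero, sum_neg_distrib, zero_sub, mul_neg, neg_neg]
  refine mul_le_mul_of_nonneg_left ?_ hβ
  calc (Fintype.card (ι → Fin (2 ^ K)) - M * ∏ j, (2 : ℝ) ^ (s j + 1))
      ≤ Fintype.card (ι → Fin (2 ^ K)) - ∑ k, ∑ a : ι → Fin (2 ^ K), boxInd s (y k) a := by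
        refine sub_le_sub_left ?_ _
        refine (sum_le_sum fun k _ => sum_boxInd_le K s (y k)).trans (le_of_eq ?_)
        simp
    _ = ∑ a : ι → Fin (2 ^ K), (1 - ∑ k, boxInd s (y k) a) := by
        rw [sum_comm, sum_sub_distrib]; simp
    _ ≤ _ := sum_le_sum fun a _ => one_sub_sum_le_emptyInd s y a

/-- Odd functions at fine scales correlate little with the discrepancy function. -/
lemma abs_sum_mul_gridDisc_le {K M : ℕ} {s : ι → ℕ} (hs : ∀ j, s j < K)
    {H : (ι → Fin (2 ^ K)) → ℝ} (hH : ∀ j a, H (reflect K j (s j) a) = -H a) {B : ℝ}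
    (hB : ∀ a, |H a| ≤ B) (hB0 : 0 ≤ B) (c : Fin M → ℝ) (hc : ∀ k, |c k| ≤ 1) (y : Fin M → ι → ℕ)
    (α β : ι → ℝ) (hβ : 0 ≤ ∏ j, β j * 2 ^ s j / 2) :
    |∑ a, H a * gridDisc c y α β a| ≤ B * (M * ∏ j, (2 : ℝ) ^ (s j + 1)
      + (∏ j, β j * 2 ^ s j / 2) * Fintype.card (ι → Fin (2 ^ K))) := by
  rw [sum_mul_gridDisc hs hH, mul_add]
  refine (abs_sub _ _).trans (add_le_add ?_ ?_)
  · calc _ ≤ ∑ k : Fin M, B * ∏ j, (2 : ℝ) ^ (s j + 1) := by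
          refine (abs_sum_le_sum_abs _ _).trans (sum_le_sum fun k _ => ?_)
          rw [abs_mul]
          calc _ ≤ 1 * ∑ a, |H a * (geInd (y k) a * boxInd s (y k) a)| :=
                mul_le_mul (hc k) (abs_sum_le_sum_abs _ _) (abs_nonneg _) zero_le_one
            _ ≤ ∑ a : ι → Fin (2 ^ K), B * boxInd s (y k) a := by
                rw [one_mul]
                refine sum_le_sum fun a _ => ?_
                have h1 := boxInd_nonneg s (y k) a
                have h2 := geInd_nonneg (y k) a
                rw [abs_mul, abs_of_nonneg (mul_nonneg h2 h1)]
                refine mul_le_mul (hB a) ?_ (mul_nonneg h2 h1) hB0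
                exact mul_le_of_le_one_left h1 (geInd_le_one (y k) a)
            _ ≤ _ := by
                rw [← mul_sum]
                exact mul_le_mul_of_nonneg_left (sum_boxInd_le K s (y k)) hB0
      _ = _ := by simp; ring
  · rw [abs_mul, abs_of_nonneg hβ, mul_left_comm]
    refine mul_le_mul_of_nonneg_left ?_ hβ
    calc _ ≤ ∑ a : ι → Fin (2 ^ K), B := by
          refine (abs_sum_le_sum_abs _ _).trans (sum_le_sum fun a _ => ?_)
          rw [abs_mul, abs_prod, prod_eq_one fun j _ => abs_rad _ _, mul_one]
          exact hB a
      _ = _ := by simp; ring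

/-- The scales of the Roth functions: coordinate `0` compensates the others so that all boxes have
the same volume. -/
def scale {d : ℕ} (K : ℕ) (i : Fin d → ℕ) : Fin (d + 1) → ℕ :=
  Fin.cons (2 * (d - 1) + ∑ j, i j) fun j => K - 3 - i j

lemma scale_lt {d J K : ℕ} (hd : 1 ≤ d) (hK : K = d * (J + 2)) {i : Fin d → ℕ} (hi : ∀ j, i j < J)
    (j : Fin (d + 1)) : scale K i j < K := by
  have hsum : ∑ j, i j ≤ d * (J - 1) := by
    refine (sum_le_sum fun j _ => (Nat.le_sub_one_of_lt (hi j))).trans (le_of_eq ?_)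
    simp
  obtain ⟨d, rfl⟩ := Nat.exists_eq_add_of_le' hd
  obtain ⟨J, rfl⟩ := Nat.exists_eq_add_of_le' (Nat.lt_of_le_of_lt (Nat.zero_le _) (hi 0) : 1 ≤ J)
  refine Fin.cases ?_ (fun j => ?_) j
  · simp only [scale, Fin.cons_zero]
    simp only [Nat.add_sub_cancel] at hsum ⊢
    subst hK
    nlinarith
  · simp only [scale, Fin.cons_succ]
    have : 0 < K := by subst hK; positivity
    omega

/-- Each box has `2^(d*K-1)` of the `2^((d+1)*K)` grid points, so there are `2^(K+1)` boxes for
`2^K` points and at least half of them are empty. -/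
lemma sum_scale {d J K : ℕ} (hd : 1 ≤ d) (hK : K = d * (J + 2)) {i : Fin d → ℕ} (hi : ∀ j, i j < J) :
    ∑ j, (scale K i j + 1) + 1 = d * K := by
  have h1 : ∀ j : Fin d, K - 3 - i j + 1 + i j + 2 = K := by
    intro j
    have h2 : J + 2 ≤ K := by subst hK; nlinarith
    have := (hi j)
    omega
  have h2 : ∑ j, (K - 3 - i j + 1) + ∑ j, i j + d * 2 = d * K := by
    have := Finset.sum_congr rfl fun (j : Fin d) (_ : j ∈ univ) => h1 j
    simpa [sum_add_distrib] using this
  simp only [scale, Fin.sum_univ_succ, Fin.cons_zero, Fin.cons_succ]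
  omega

lemma volume_factor {d J K : ℕ} (hd : 1 ≤ d) (hK : K = d * (J + 2)) {i : Fin d → ℕ} (hi : ∀ j, i j < J)
    {β : Fin (d + 1) → ℝ} (hβ : (∏ j, β j) * 2 ^ ((K + 1) * d) = 1) :
    ∏ j, β j * 2 ^ scale K i j / 2 = 1 / 8 ^ (d + 1) := by
  have h : (∏ j, β j * 2 ^ scale K i j / 2) * 4 ^ (d + 1) * 2
      = (∏ j, β j) * 2 ^ (∑ j, (scale K i j + 1) + 1) := by
    rw [pow_succ _ (∑ j, (scale K i j + 1)), ← prod_pow_eq_pow_sum]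
    have : (4 : ℝ) ^ (d + 1) = ∏ j : Fin (d + 1), 4 := by simp
    rw [this, ← mul_assoc, ← prod_mul_distrib, ← prod_mul_distrib]
    congr 1
    exact prod_congr rfl fun j _ => by ring
  rw [sum_scale hd hK hi] at h
  rw [eq_div_iff (by positivity)]
  have e : (8 : ℝ) ^ (d + 1) = 4 ^ (d + 1) * 2 * 2 ^ d := by
    rw [show (8 : ℝ) = 4 * 2 by norm_num, mul_pow]; ring
  rw [e, ← mul_assoc, ← mul_assoc, h, ← hβ]
  ring

lemma card_half {d J K : ℕ} (hd : 1 ≤ d) (hK : K = d * (J + 2)) {i : Fin d → ℕ} (hi : ∀ j, i j < J) :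
    ((2 ^ K : ℕ) : ℝ) * ∏ j, (2 : ℝ) ^ (scale K i j + 1)
      = Fintype.card (Fin (d + 1) → Fin (2 ^ K)) / 2 := by
  rw [prod_pow_eq_pow_sum, eq_div_iff two_ne_zero, mul_assoc, ← pow_succ, sum_scale hd hK hi]
  simp
  ring

lemma le_sum_rothFun_scale_mul {d J K : ℕ} (hd : 1 ≤ d) (hK : K = d * (J + 2))
    {i : Fin d → ℕ} (hi : ∀ j, i j < J) (c : Fin (2 ^ K) → ℝ) (y : Fin (2 ^ K) → Fin (d + 1) → ℕ)
    (α : Fin (d + 1) → ℝ) {β : Fin (d + 1) → ℝ} (hβ : (∏ j, β j) * 2 ^ ((K + 1) * d) = 1) :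
    1 / (2 * 8 ^ (d + 1)) * Fintype.card (Fin (d + 1) → Fin (2 ^ K))
      ≤ ∑ a : Fin (d + 1) → Fin (2 ^ K), rothFun (scale K i) y a * gridDisc c y α β a := by
  have h := le_sum_rothFun_mul_gridDisc (scale_lt hd hK hi) c y α β
    (by rw [volume_factor hd hK hi hβ]; positivity)
  rw [volume_factor hd hK hi hβ, card_half hd hK hi] at h
  refine le_trans (le_of_eq ?_) h
  field_simp
  ring

/-- A lower bound of order `J ^ (d / 2)` for the `L_p` averages of all discrepancy functions on
grids of `2 ^ (d * (J + 2))` points per coordinate. -/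
def GridLowerBound (d : ℕ) (p : ℝ) : Prop :=
  ∃ γ : ℝ, 0 < γ ∧ ∃ J₀ : ℕ, ∀ J ≥ J₀, ∀ K, K = d * (J + 2) →
    ∀ (c : Fin (2 ^ K) → ℝ) (y : Fin (2 ^ K) → Fin (d + 1) → ℕ) (α β : Fin (d + 1) → ℝ),
      (∀ k, |c k| ≤ 1) → (∏ j, β j) * 2 ^ ((K + 1) * d) = 1 →
      γ * Fintype.card (Fin (d + 1) → Fin (2 ^ K)) * ((J : ℝ) ^ ((d : ℝ) / 2)) ^ p
        ≤ ∑ a : Fin (d + 1) → Fin (2 ^ K), |gridDisc c y α β a| ^ p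

end RothFunctions

/-! ### The grid bound for `p > 1`, and algebra for the Riesz product. -/

section GridBounds

lemma rpow_le_one_add_sq_pow {z q : ℝ} (hz : 0 ≤ z) (hq : 0 ≤ q) {m : ℕ} (hm : q ≤ 2 * (m + 1)) :
    z ^ q ≤ 1 + (z ^ 2) ^ (m + 1) := by
  rcases le_total z 1 with h | h
  · exact (Real.rpow_le_one hz h hq).trans (le_add_of_nonneg_right (by positivity))
  · calc z ^ q ≤ z ^ ((2 * (m + 1) : ℕ) : ℝ) :=
          Real.rpow_le_rpow_of_exponent_le h (by push_cast; exact hm)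
      _ = (z ^ 2) ^ (m + 1) := by rw [Real.rpow_natCast, pow_mul]
      _ ≤ _ := by linarith

theorem gridLowerBound_of_one_lt {d : ℕ} (hd : 1 ≤ d) {p : ℝ} (hp : 1 < p) :
    GridLowerBound d p := by
  set q := p.conjExponent
  have hpq : p.HolderConjugate q := Real.HolderConjugate.conjExponent hp
  have hq0 : 0 < q := hpq.symm.pos
  obtain ⟨m, hm⟩ := exists_nat_ge q
  have hm' : q ≤ 2 * (m + 1) := by
    have : (0 : ℝ) ≤ m := m.cast_nonneg
    linarith
  obtain ⟨C, hC, hmom⟩ := exists_multi_moment_le m d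
  set c₀ : ℝ := 1 / (2 * 8 ^ (d + 1)) with hc₀
  have hc₀' : 0 < c₀ := by positivity
  -- The Young parameter is chosen so that the `q`-th moment term consumes exactly half of the main
  -- term.
  set δ : ℝ := (c₀ / (2 * (1 + C))) ^ (1 / q) with hδ
  have hδ0 : 0 < δ := by positivity
  have hδq : δ ^ q * (1 + C) = c₀ / 2 := by
    rw [hδ, ← Real.rpow_mul (by positivity), one_div, inv_mul_cancel₀ hq0.ne', Real.rpow_one]
    field_simp
  refine ⟨c₀ / 2 * δ ^ p, by positivity, 1, ?_⟩
  intro J hJ K hK c y α β _ hβ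
  set n : ℝ := (Fintype.card (Fin (d + 1) → Fin (2 ^ K)) : ℝ) with hn
  set R : ℝ := (J : ℝ) ^ ((d : ℝ) / 2) with hR
  have hJ0 : (0 : ℝ) < J := by exact_mod_cast hJ
  have hR0 : 0 < R := by positivity
  have hR2 : R ^ 2 = (J : ℝ) ^ d := by
    rw [hR, ← Real.rpow_natCast, ← Real.rpow_mul hJ0.le, ← Real.rpow_natCast]
    congr 1
    push_cast
    ring
  set f : (Fin d → Fin J) → (Fin (d + 1) → Fin (2 ^ K)) → ℝ :=
    fun i => rothFun (scale K fun j => (i j : ℕ)) y with hf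
  set D := gridDisc (K := K) c y α β with hD
  have hmain : c₀ * n * R ^ 2 ≤ ∑ a, (∑ i, f i a) * D a := by
    simp only [sum_mul]
    rw [sum_comm]
    calc c₀ * n * R ^ 2 = ∑ i : Fin d → Fin J, c₀ * n := by
          rw [hR2]; simp; ring
      _ ≤ _ := sum_le_sum fun i _ => le_sum_rothFun_scale_mul hd hK (fun j => (i j).2) c y α hβ
  have hlt : ∀ i : Fin d → Fin J, ∀ j, scale K (fun j => (i j : ℕ)) j < K :=
    fun i => scale_lt hd hK fun j => (i j).2
  have hmoment : ∑ a, ((∑ i, f i a) ^ 2) ^ (m + 1) ≤ C * (n * (R ^ 2) ^ (m + 1)) := by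
    -- A larger index means a finer digit in coordinate `j.succ`, as the martingale order requires.
    -- Coordinate `0`, whose scale depends on all indices, is never reflected.
    have h := hmom ℝ (Fin (d + 1) → Fin (2 ^ K)) J (fun j t => reflect K j.succ (K - 3 - t)) f
      (fun i j x => rothFun_reflect_self y (hlt i j.succ) x)
      (fun i j s x hs => by
        refine rothFun_reflect_of_lt y ?_ (hlt i j.succ) x
        have h1 := s.2
        have h2 : J + 2 ≤ K := by subst hK; nlinarith
        have h3 : (i j : ℕ) < s := hs
        simp only [scale, Fin.cons_succ]
        omega)
    simp only [Real.norm_eq_abs, sq_abs] at h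
    refine h.trans (mul_le_mul_of_nonneg_left ?_ hC)
    calc ∑ a, (∑ i, f i a ^ 2) ^ (m + 1)
        ≤ ∑ a : Fin (d + 1) → Fin (2 ^ K), (R ^ 2) ^ (m + 1) := by
          refine sum_le_sum fun a _ => pow_le_pow_left₀ (sum_nonneg fun i _ => sq_nonneg _) ?_ _
          calc ∑ i, f i a ^ 2 ≤ ∑ i : Fin d → Fin J, (1 : ℝ) :=
                sum_le_sum fun i _ => (sq_le_one_iff_abs_le_one _).2 (abs_rothFun_le _ y a)
            _ = R ^ 2 := by rw [hR2]; simp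
      _ = _ := by simp [hn]
  have hpt : ∀ a, (∑ i, f i a) * D a ≤ R ^ 2 * (|D a| ^ p / (R * δ) ^ p
      + δ ^ q * (1 + ((∑ i, f i a) ^ 2) ^ (m + 1) / (R ^ 2) ^ (m + 1))) := by
    intro a
    set F := ∑ i, f i a
    -- `D` is measured in units of `R * δ` and `F` in units of `R / δ`, since both have expected
    -- size `R`.
    have hy := Real.young_inequality_of_nonneg (a := |D a| / (R * δ)) (b := δ * (|F| / R))
      (by positivity) (by positivity) hpq
    have h1 : (|D a| / (R * δ)) ^ p / p ≤ |D a| ^ p / (R * δ) ^ p := by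
      rw [← Real.div_rpow (abs_nonneg _) (by positivity)]
      exact div_le_self (by positivity) hp.le
    have h2 : (δ * (|F| / R)) ^ q / q ≤ δ ^ q * (1 + (F ^ 2) ^ (m + 1) / (R ^ 2) ^ (m + 1)) := by
      refine (div_le_self (by positivity) hpq.symm.lt.le).trans ?_
      rw [Real.mul_rpow hδ0.le (by positivity), ← div_pow, ← sq_abs F, ← div_pow]
      exact mul_le_mul_of_nonneg_left (rpow_le_one_add_sq_pow (by positivity) hq0.le hm')
        (by positivity)
    calc F * D a ≤ |F| * |D a| := by rw [← abs_mul]; exact le_abs_self _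
      _ = R ^ 2 * (|D a| / (R * δ) * (δ * (|F| / R))) := by field_simp
      _ ≤ _ := by gcongr; linarith
  have hsum := hmain.trans (sum_le_sum fun a _ => hpt a)
  rw [← mul_sum, mul_comm _ (R ^ 2)] at hsum
  have hsum' := le_of_mul_le_mul_left hsum (by positivity)
  rw [sum_add_distrib, ← mul_sum, sum_add_distrib, ← sum_div, ← sum_div] at hsum'
  have hone : ∑ a : Fin (d + 1) → Fin (2 ^ K), (1 : ℝ) = n := by simp [hn]
  rw [hone] at hsum'
  have h3 : (∑ a, ((∑ i, f i a) ^ 2) ^ (m + 1)) / (R ^ 2) ^ (m + 1) ≤ C * n := by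
    rw [div_le_iff₀ (by positivity)]
    linarith
  have h4 : δ ^ q * (n + (∑ a, ((∑ i, f i a) ^ 2) ^ (m + 1)) / (R ^ 2) ^ (m + 1))
      ≤ c₀ / 2 * n := by
    calc _ ≤ δ ^ q * (n + C * n) := by gcongr
      _ = δ ^ q * (1 + C) * n := by ring
      _ = _ := by rw [hδq]
  have h5 : c₀ / 2 * n ≤ (∑ a, |D a| ^ p) / (R * δ) ^ p := by linarith
  rw [le_div_iff₀ (by positivity), Real.mul_rpow hR0.le hδ0.le] at h5
  linarith

lemma prod_one_add_eq {A : Type*} [CommRing A] (z : ℕ → A) (k : ℕ) :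
    ∏ l ∈ range k, (1 + z l) = 1 + ∑ j ∈ range k, z j * ∏ l ∈ Ioo j k, (1 + z l) := by
  induction k with
  | zero => simp
  | succ k ih =>
    have e : ∀ j ∈ range k, z j * ∏ l ∈ Ioo j (k + 1), (1 + z l)
        = z j * (∏ l ∈ Ioo j k, (1 + z l)) * (1 + z k) := by
      intro j hj
      have : Ioo j (k + 1) = insert k (Ioo j k) := by
        ext l; simp only [mem_Ioo, mem_insert, mem_range] at *; omega
      rw [this, prod_insert (by simp)]
      ring
    have e' : Ioo k (k + 1) = ∅ := by ext l; simp only [mem_Ioo, notMem_empty, iff_false]; omega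
    rw [prod_range_succ, ih, sum_range_succ, sum_congr rfl e, ← sum_mul, e', prod_empty]
    ring

/-- Monomials with at least two factors are grouped by their smallest index `j` and largest index
`k`; the indices in between remain free. -/
lemma prod_one_add_eq_add_pairs {A : Type*} [CommRing A] (z : ℕ → A) (J : ℕ) :
    ∏ l ∈ range J, (1 + z l) = 1 + ∑ k ∈ range J, z k
      + ∑ k ∈ range J, ∑ j ∈ range k, z j * z k * ∏ l ∈ Ioo j k, (1 + z l) := by
  induction J with
  | zero => simp
  | succ J ih =>
    have h := prod_one_add_eq z J
    rw [prod_range_succ, mul_add, mul_one, sum_range_succ, sum_range_succ]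
    nth_rewrite 2 [h]
    rw [ih, add_mul, sum_mul, one_mul]
    have e : ∑ j ∈ range J, z j * z J * ∏ l ∈ Ioo j J, (1 + z l)
        = ∑ j ∈ range J, z j * (∏ l ∈ Ioo j J, (1 + z l)) * z J :=
      sum_congr rfl fun j _ => by ring
    rw [e]
    ring

-- Each factor has squared modulus at most `1 + t²`, so the squared product is at most `exp (J t²) ≤
-- e < 4`.
open Complex in
lemma norm_prod_one_add_mul_I_le {J : ℕ} {t : ℝ} (ht : J * t ^ 2 ≤ 1) {S : Finset ℕ}
    (hS : S ⊆ range J) {f : ℕ → ℝ} (hf : ∀ l, |f l| ≤ 1) :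
    ‖∏ l ∈ S, (1 + (t * f l : ℝ) * I)‖ ≤ 2 := by
  have h : ‖∏ l ∈ S, (1 + (t * f l : ℝ) * I)‖ ^ 2 ≤ 2 ^ 2 := by
    rw [norm_prod, ← prod_pow]
    calc ∏ l ∈ S, ‖1 + ((t * f l : ℝ) : ℂ) * I‖ ^ 2 ≤ ∏ l ∈ S, Real.exp (t ^ 2) := by
          refine prod_le_prod (fun l _ => by positivity) fun l _ => ?_
          have e : ‖1 + ((t * f l : ℝ) : ℂ) * I‖ ^ 2 = 1 + t ^ 2 * f l ^ 2 := by
            rw [Complex.sq_norm, Complex.normSq_apply]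
            simp
            ring
          have : f l ^ 2 ≤ 1 := (sq_le_one_iff_abs_le_one _).2 (hf l)
          rw [e]
          nlinarith [Real.add_one_le_exp (t ^ 2), sq_nonneg t]
      _ = Real.exp (#S * t ^ 2) := by rw [prod_const, ← Real.exp_nat_mul]
      _ ≤ Real.exp 1 := by
          refine Real.exp_le_exp.2 (le_trans ?_ ht)
          have : #S ≤ J := by simpa using card_le_card hS
          gcongr
      _ ≤ 2 ^ 2 := by linarith [Real.exp_one_lt_d9]
  exact (sq_le_sq₀ (norm_nonneg _) zero_le_two).1 h

lemma sum_range_half_pow_le (k : ℕ) : ∑ j ∈ range k, (1 / 2 : ℝ) ^ (k - j) ≤ 1 := by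
  have : ∑ j ∈ range k, (1 / 2 : ℝ) ^ (k - j) = 1 - (1 / 2) ^ k := by
    induction k with
    | zero => simp
    | succ k ih =>
      have e : ∀ j ∈ range k, (1 / 2 : ℝ) ^ (k + 1 - j) = (1 / 2) ^ (k - j) * (1 / 2) :=
        fun j hj => by
          rw [← pow_succ, Nat.sub_add_comm (mem_range.1 hj).le]
      rw [sum_range_succ, sum_congr rfl e, ← sum_mul, ih]
      simp
      ring
  rw [this]
  linarith [pow_pos (by norm_num : (0 : ℝ) < 1 / 2) k]

end GridBounds

/-! ### Halász's Riesz product: the case `d = p = 1`. -/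

section RieszProduct

/-- The Roth function in dimension one (plus time) with scales `l` and `K - 3 - l`. -/
def planarRoth {K M : ℕ} (y : Fin M → Fin 2 → ℕ) (l : ℕ) (a : Fin 2 → Fin (2 ^ K)) : ℝ :=
  rothFun ![l, K - 3 - l] y a

lemma scale_one (K l : ℕ) : scale K (fun _ : Fin 1 => l) = ![l, K - 3 - l] := by
  ext j
  fin_cases j <;> simp [scale]

open Complex in
/-- The part of the Riesz product coming from all products whose extreme factors are the `j`-th and
the `k`-th one. -/
noncomputable def rieszPair {K M : ℕ} (y : Fin M → Fin 2 → ℕ) (t : ℝ) (j k : ℕ)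
    (a : Fin 2 → Fin (2 ^ K)) : ℝ :=
  planarRoth y j a * planarRoth y k a
    * (∏ l ∈ Ioo j k, (1 + ((t * planarRoth y l a : ℝ) : ℂ) * I)).im

open Complex in
/-- The bounded test function `Im ∏ l, (1 + i t f l)`. -/
noncomputable def rieszFun {K M : ℕ} (J : ℕ) (y : Fin M → Fin 2 → ℕ) (t : ℝ)
    (a : Fin 2 → Fin (2 ^ K)) : ℝ :=
  (∏ l ∈ range J, (1 + ((t * planarRoth y l a : ℝ) : ℂ) * I)).im

lemma rieszFun_eq {K M : ℕ} (J : ℕ) (y : Fin M → Fin 2 → ℕ) (t : ℝ) (a : Fin 2 → Fin (2 ^ K)) :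
    rieszFun J y t a = t * ∑ k ∈ range J, planarRoth y k a
      - t ^ 2 * ∑ k ∈ range J, ∑ j ∈ range k, rieszPair y t j k a := by
  have e : ∀ (r s : ℝ) (z : ℂ), ((r : ℂ) * Complex.I * ((s : ℂ) * Complex.I) * z).im
      = -(r * s * z.im) := fun r s z => by
    have : (r : ℂ) * Complex.I * ((s : ℂ) * Complex.I) * z = ((-(r * s) : ℝ) : ℂ) * z := by
      push_cast
      linear_combination (r * s * z : ℂ) * Complex.I_mul_I
    rw [this, Complex.im_ofReal_mul]
    ring
  rw [rieszFun, prod_one_add_eq_add_pairs]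
  simp only [Complex.add_im, Complex.im_sum, e, Complex.one_im, zero_add, rieszPair, mul_sum]
  rw [sub_eq_add_neg, ← sum_neg_distrib]
  congr 1
  · exact sum_congr rfl fun k _ => by simp
  · refine sum_congr rfl fun k _ => ?_
    rw [← sum_neg_distrib]
    exact sum_congr rfl fun j _ => by ring

lemma abs_rieszFun_le {K M J : ℕ} (y : Fin M → Fin 2 → ℕ) {t : ℝ} (ht : J * t ^ 2 ≤ 1)
    (a : Fin 2 → Fin (2 ^ K)) : |rieszFun J y t a| ≤ 2 :=
  (Complex.abs_im_le_norm _).trans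
    (norm_prod_one_add_mul_I_le ht subset_rfl fun _ => abs_rothFun_le _ y a)

lemma abs_rieszPair_le {K M J : ℕ} (y : Fin M → Fin 2 → ℕ) {t : ℝ} (ht : J * t ^ 2 ≤ 1)
    {j k : ℕ} (hk : k < J) (a : Fin 2 → Fin (2 ^ K)) : |rieszPair y t j k a| ≤ 2 := by
  have h : |(∏ l ∈ Ioo j k, (1 + ((t * planarRoth y l a : ℝ) : ℂ) * Complex.I)).im| ≤ 2 :=
    (Complex.abs_im_le_norm _).trans (norm_prod_one_add_mul_I_le ht
      (fun l hl => mem_range.2 ((mem_Ioo.1 hl).2.trans hk)) fun _ => abs_rothFun_le _ y a)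
  rw [rieszPair, abs_mul, abs_mul]
  have h1 : |planarRoth y j a| ≤ 1 := abs_rothFun_le _ y a
  have h2 : |planarRoth y k a| ≤ 1 := abs_rothFun_le _ y a
  calc _ ≤ (1 : ℝ) * 1 * 2 := by gcongr
    _ = 2 := by norm_num

/-- Among the scales `(l, K-3-l)` with `j ≤ l ≤ k`, the finest in coordinate `0` belongs only to `l
= j` and the finest in coordinate `1` only to `l = k`. Reflecting at such a scale changes the sign
of one factor and fixes the others. -/
lemma rieszPair_reflect {K M J : ℕ} (hK : K = J + 2) (y : Fin M → Fin 2 → ℕ) (t : ℝ)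
    {j k : ℕ} (hjk : j < k) (hk : k < J) (i : Fin 2) (a : Fin 2 → Fin (2 ^ K)) :
    rieszPair y t j k (reflect K i (![j, K - 3 - k] i) a) = -rieszPair y t j k a := by
  fin_cases i
  · have hl : ∀ l, j < l → l ≤ k → planarRoth y l (reflect K 0 j a) = planarRoth y l a :=
      fun l h1 h2 => rothFun_reflect_of_lt (s := ![l, K - 3 - l]) y h1 (by simp; omega) a
    have hj : planarRoth y j (reflect K 0 j a) = -planarRoth y j a :=
      rothFun_reflect_self (s := ![j, K - 3 - j]) y (j := 0) (by simp; omega) a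
    simp only [rieszPair, Fin.zero_eta, Matrix.cons_val_zero, hj, hl k hjk le_rfl]
    rw [prod_congr rfl fun l h => by rw [hl l (mem_Ioo.1 h).1 (mem_Ioo.1 h).2.le]]
    ring
  · have hl : ∀ l, l < k → planarRoth y l (reflect K 1 (K - 3 - k) a) = planarRoth y l a :=
      fun l h2 => rothFun_reflect_of_lt (s := ![l, K - 3 - l]) y (by simp; omega)
        (by simp; omega) a
    have hj : planarRoth y k (reflect K 1 (K - 3 - k) a) = -planarRoth y k a :=
      rothFun_reflect_self (s := ![k, K - 3 - k]) y (j := 1) (by simp; omega) a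
    simp only [rieszPair, Fin.mk_one, Matrix.cons_val_one, Matrix.cons_val_zero, hj, hl j hjk]
    rw [prod_congr rfl fun l h => by rw [hl l (mem_Ioo.1 h).2]]
    ring

/-- The pair is odd on boxes smaller by a factor `2^(k-j)` than those of the Roth functions, and
both the count and the volume terms scale with box size. -/
lemma abs_sum_rieszPair_mul_le {K J : ℕ} (hK : K = J + 2) (c : Fin (2 ^ K) → ℝ)
    (hc : ∀ k, |c k| ≤ 1) (y : Fin (2 ^ K) → Fin 2 → ℕ) (α : Fin 2 → ℝ) {β : Fin 2 → ℝ}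
    (hβ : (∏ j, β j) * 2 ^ (K + 1) = 1) {t : ℝ} (ht : J * t ^ 2 ≤ 1) {j k : ℕ} (hjk : j < k)
    (hk : k < J) :
    |∑ a : Fin 2 → Fin (2 ^ K), rieszPair y t j k a * gridDisc c y α β a|
      ≤ 4 * Fintype.card (Fin 2 → Fin (2 ^ K)) * (1 / 2) ^ (k - j) := by
  obtain ⟨e, he⟩ : ∃ e, K = e + (k - j) + j + 3 := ⟨K - 3 - k, by omega⟩
  have hs : K - 3 - k = e := by omega
  have hvol : ∏ i, β i * 2 ^ (![j, K - 3 - k] i) / 2 = 1 / 64 * (1 / 2) ^ (k - j) := by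
    simp only [Fin.prod_univ_two, Matrix.cons_val_zero, Matrix.cons_val_one] at hβ ⊢
    rw [hs]
    generalize k - j = r at he
    have h1 : β 0 * 2 ^ j / 2 * (β 1 * 2 ^ e / 2) * 2 ^ (r + 6)
        = β 0 * β 1 * 2 ^ (K + 1) := by
      rw [he]; ring
    rw [hβ, pow_add] at h1
    rw [one_div_pow]
    field_simp
    field_simp at h1
    linarith
  have hcount : ((2 ^ K : ℕ) : ℝ) * ∏ i, (2 : ℝ) ^ (![j, K - 3 - k] i + 1)
      = Fintype.card (Fin 2 → Fin (2 ^ K)) * (1 / 2) * (1 / 2) ^ (k - j) := by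
    simp only [Fin.prod_univ_two, Matrix.cons_val_zero, Matrix.cons_val_one]
    rw [hs]
    generalize k - j = r at he
    simp only [Fintype.card_pi, Fintype.card_fin, prod_const, card_univ]
    rw [one_div_pow]
    push_cast
    rw [he]
    field_simp
    ring
  have h := abs_sum_mul_gridDisc_le (s := ![j, K - 3 - k])
    (fun i => by fin_cases i <;> simp <;> omega) (rieszPair_reflect hK y t hjk hk)
    (abs_rieszPair_le y ht hk) zero_le_two c hc y α β (by rw [hvol]; positivity)
  rw [hvol, hcount] at h
  refine h.trans ?_
  have : 0 ≤ (Fintype.card (Fin 2 → Fin (2 ^ K)) : ℝ) * (1 / 2) ^ (k - j) := by positivity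
  linarith

theorem gridLowerBound_one_one : GridLowerBound 1 1 := by
  -- The main term is `R n / 128` and the pairs cost at most `4 n`. For `R = √J ≥ 1024` the cost is
  -- at most `R n / 256`, and the sup bound `2` of the test function halves what is left.
  refine ⟨1 / 512, by norm_num, 2 ^ 20, ?_⟩
  intro J hJ K hK c y α β hc hβ
  simp only [mul_one, one_mul, Nat.cast_one] at hK hβ ⊢
  simp only [Real.rpow_one]
  rw [← Real.sqrt_eq_rpow]
  set D := gridDisc (K := K) c y α β
  set n : ℝ := (Fintype.card (Fin (1 + 1) → Fin (2 ^ K)) : ℝ) with hn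
  have hn0 : 0 ≤ n := by positivity
  have hJ0 : (2 : ℝ) ^ 20 ≤ J := by exact_mod_cast hJ
  set R := √(J : ℝ) with hR
  have hRJ : R * R = J := Real.mul_self_sqrt (by positivity)
  have hR0 : 1024 ≤ R := Real.le_sqrt_of_sq_le (by norm_num at hJ0 ⊢; exact hJ0)
  have hRpos : 0 < R := by linarith
  set t := 1 / R with ht
  have htR : t * R = 1 := by rw [ht]; field_simp
  have htJ : J * t ^ 2 = 1 := by rw [← hRJ]; linear_combination (t * R + 1) * htR
  have htJ' : t * J = R := by rw [← hRJ]; linear_combination R * htR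
  have hmain : ∀ k ∈ range J, 1 / 128 * n ≤ ∑ a, planarRoth y k a * D a := by
    intro k hk
    have h := le_sum_rothFun_scale_mul le_rfl (by omega) (i := fun _ : Fin 1 => k)
      (fun _ => mem_range.1 hk) c y α (β := β) (by simpa using hβ)
    rw [scale_one] at h
    refine le_trans (le_of_eq ?_) h
    rw [← hn]
    norm_num
  have hsum : ∑ a, rieszFun J y t a * D a
      = t * ∑ k ∈ range J, ∑ a, planarRoth y k a * D a
        - t ^ 2 * ∑ k ∈ range J, ∑ j ∈ range k, ∑ a, rieszPair y t j k a * D a := by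
    simp only [rieszFun_eq, sub_mul, sum_sub_distrib, mul_sum, sum_mul]
    congr 1
    · rw [sum_comm]
      exact sum_congr rfl fun k _ => sum_congr rfl fun a _ => by ring
    · rw [sum_comm]
      refine sum_congr rfl fun k _ => ?_
      rw [sum_comm]
      exact sum_congr rfl fun j _ => sum_congr rfl fun a _ => by ring
  have h1 : R * (1 / 128 * n) ≤ t * ∑ k ∈ range J, ∑ a, planarRoth y k a * D a := by
    calc R * (1 / 128 * n) = t * ∑ k ∈ range J, 1 / 128 * n := by
          rw [← htJ', sum_const, card_range, nsmul_eq_mul]; ring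
      _ ≤ _ := mul_le_mul_of_nonneg_left (sum_le_sum hmain) (by positivity)
  have h2 : t ^ 2 * ∑ k ∈ range J, ∑ j ∈ range k,
      ∑ a, rieszPair y t j k a * D a ≤ 4 * n := by
    calc _ ≤ t ^ 2 * ∑ k ∈ range J, ∑ j ∈ range k, 4 * n * (1 / 2) ^ (k - j) := by
          gcongr with k hk j hj
          exact (le_abs_self _).trans (abs_sum_rieszPair_mul_le hK c hc y α (by simpa using hβ)
            htJ.le (mem_range.1 hj) (mem_range.1 hk))
      _ ≤ t ^ 2 * ∑ k ∈ range J, 4 * n * 1 := by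
          gcongr with k hk
          rw [← mul_sum]
          gcongr
          exact sum_range_half_pow_le k
      _ = J * t ^ 2 * (4 * n) := by rw [sum_const, card_range, nsmul_eq_mul]; ring
      _ = 4 * n := by rw [htJ, one_mul]
  have h3 : ∑ a, rieszFun J y t a * D a ≤ 2 * ∑ a, |D a| := by
    rw [mul_sum]
    refine sum_le_sum fun a _ => (le_abs_self _).trans ?_
    rw [abs_mul]
    exact mul_le_mul_of_nonneg_right (abs_rieszFun_le y htJ.le a) (abs_nonneg _)
  rw [hsum] at h3
  have h4 : 1024 * n ≤ R * n := by gcongr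
  linarith

end RieszProduct

/-! ### Measurability and comparison of the extreme discrepancy with grid averages. -/

section Transfer

lemma localDisc_box_eq {d N : ℕ} (P : Fin N → Fin d → ℝ) (u v : Fin d → ℝ) :
    localDisc P (box u v)
      = ∑ k, ∏ j, (if u j ≤ P k j ∧ P k j < v j then (1 : ℝ) else 0)
        - N * ∏ j, max (v j - u j) 0 := by
  classical
  unfold localDisc count box
  congr 1
  · rw [Nat.card_eq_fintype_card, Fintype.card_subtype, card_filter]
    push_cast
    refine sum_congr rfl fun k _ => ?_
    rw [Fintype.prod_ite_zero]
    simp only [Set.mem_univ_pi, Set.mem_Ico, prod_const_one]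
  · rw [measureReal_def, Real.volume_pi_Ico, ENNReal.toReal_prod]
    simp only [ENNReal.toReal_ofReal']

lemma measurable_localDisc_box {d N : ℕ} (P : Fin N → Fin d → ℝ) :
    Measurable fun z : (Fin d → ℝ) × (Fin d → ℝ) => localDisc P (box z.2 z.1) := by
  simp only [localDisc_box_eq]
  refine Measurable.sub (Finset.measurable_sum _ fun k _ => Finset.measurable_prod _ fun j _ => ?_)
    (measurable_const.mul (Finset.measurable_prod _ fun j _ => by fun_prop))
  refine Measurable.ite ?_ measurable_const measurable_const
  exact (measurableSet_le (f := fun z : (Fin d → ℝ) × (Fin d → ℝ) => z.2 j) (by fun_prop)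
      measurable_const).inter
    (measurableSet_lt (g := fun z : (Fin d → ℝ) × (Fin d → ℝ) => z.1 j) measurable_const
      (by fun_prop))

lemma abs_localDisc_box_le {d N : ℕ} (P : Fin N → Fin d → ℝ) {u v : Fin d → ℝ}
    (hu : u ∈ Set.Icc (0 : Fin d → ℝ) 1) (hv : v ∈ Set.Icc (0 : Fin d → ℝ) 1) :
    |localDisc P (box u v)| ≤ 2 * N := by
  rw [localDisc_box_eq]
  have h1 : 0 ≤ ∏ j, max (v j - u j) 0 := prod_nonneg fun j _ => le_max_right _ _
  have h2 : ∏ j, max (v j - u j) 0 ≤ 1 := prod_le_one (fun j _ => le_max_right _ _) fun j _ =>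
    max_le (by have := hu.1 j; have := hv.2 j; simp only [Pi.zero_apply, Pi.one_apply] at *; linarith)
      zero_le_one
  have h3 : ∑ k, ∏ j, (if u j ≤ P k j ∧ P k j < v j then (1 : ℝ) else 0) ≤ N := by
    calc _ ≤ ∑ k : Fin N, (1 : ℝ) := sum_le_sum fun k _ =>
          prod_le_one (fun j _ => by split_ifs <;> norm_num) fun j _ => by split_ifs <;> norm_num
      _ = N := by simp
  have h4 : 0 ≤ ∑ k, ∏ j, (if u j ≤ P k j ∧ P k j < v j then (1 : ℝ) else 0) :=
    sum_nonneg fun k _ => prod_nonneg fun j _ => by split_ifs <;> norm_num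
  have h5 : (0 : ℝ) ≤ N := N.cast_nonneg
  have h6 : N * ∏ j, max (v j - u j) 0 ≤ N * 1 := mul_le_mul_of_nonneg_left h2 h5
  have h7 : 0 ≤ N * ∏ j, max (v j - u j) 0 := mul_nonneg h5 h1
  rw [abs_le]
  constructor <;> linarith

/-- The `p`-th power of the extreme `L_p` discrepancy dominates the integral over the pairs
`(u, v)` with `u ∈ A` and `v ∈ B`, whenever `A` lies below `B`. -/
lemma lintegral_le_ofReal_extreme {d N : ℕ} {p : ℝ} (hp : 0 ≤ p) (P : Fin N → Fin d → ℝ)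
    {A B : Set (Fin d → ℝ)} (hA : A ⊆ Set.Icc 0 1) (hB : B ⊆ Set.Icc 0 1)
    (hAB : ∀ u ∈ A, ∀ v ∈ B, u ≤ v) (hAm : MeasurableSet A) (hBm : MeasurableSet B) :
    ∫⁻ u in A, ∫⁻ v in B, ENNReal.ofReal (|localDisc P (box u v)| ^ p)
      ≤ ENNReal.ofReal (∫ v in Set.Icc (0 : Fin d → ℝ) 1,
          ∫ u in {u ∈ Set.Icc (0 : Fin d → ℝ) 1 | u ≤ v}, |localDisc P (box u v)| ^ p) := by
  set μ : Measure (Fin d → ℝ) := volume.restrict (Set.Icc 0 1) with hμ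
  have : IsFiniteMeasure μ := ⟨by
    rw [hμ, Measure.restrict_apply_univ]
    exact isCompact_Icc.measure_lt_top⟩
  set h : (Fin d → ℝ) × (Fin d → ℝ) → ℝ :=
    {z | z.2 ≤ z.1}.indicator fun z => |localDisc P (box z.2 z.1)| ^ p with hh
  have hset : MeasurableSet {z : (Fin d → ℝ) × (Fin d → ℝ) | z.2 ≤ z.1} :=
    (isClosed_le continuous_snd continuous_fst).measurableSet
  have hmeas : Measurable h :=
    ((measurable_localDisc_box P).abs.pow_const p).indicator hset
  have hnn : ∀ z, 0 ≤ h z := fun z => Set.indicator_nonneg (fun z _ => by positivity) z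
  -- Integrability lets the iterated Bochner integral become a Lebesgue one, where the variables can
  -- be exchanged and the domain shrunk freely.
  have hint : Integrable h (μ.prod μ) := by
    refine Integrable.of_bound hmeas.aestronglyMeasurable ((2 * N : ℝ) ^ p) ?_
    have hμμ : μ.prod μ = (volume.prod volume).restrict
        (Set.Icc (0 : Fin d → ℝ) 1 ×ˢ Set.Icc (0 : Fin d → ℝ) 1) := Measure.prod_restrict _ _
    rw [hμμ]
    filter_upwards [ae_restrict_mem (measurableSet_Icc.prod measurableSet_Icc)] with z hz
    rw [Real.norm_of_nonneg (hnn z)]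
    refine (Set.indicator_le_self' (fun _ _ => by positivity) z).trans ?_
    exact Real.rpow_le_rpow (abs_nonneg _) (abs_localDisc_box_le P hz.2 hz.1) hp
  have e1 : (∫ v in Set.Icc (0 : Fin d → ℝ) 1,
      ∫ u in {u ∈ Set.Icc (0 : Fin d → ℝ) 1 | u ≤ v}, |localDisc P (box u v)| ^ p)
      = ∫ z, h z ∂(μ.prod μ) := by
    rw [integral_prod _ hint]
    refine integral_congr_ae (Filter.Eventually.of_forall fun v => ?_)
    have : ∀ u, h (v, u) = {u | u ≤ v}.indicator (fun u => |localDisc P (box u v)| ^ p) u :=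
      fun u => rfl
    simp only [this]
    rw [hμ]
    exact (setIntegral_indicator measurableSet_Iic).symm
  rw [e1, ofReal_integral_eq_lintegral_ofReal hint (Filter.Eventually.of_forall hnn),
    lintegral_prod_symm _ hmeas.ennreal_ofReal.aemeasurable]
  refine (lintegral_mono_set' (Filter.Eventually.of_forall hA)).trans' ?_
  refine setLIntegral_mono' hAm fun u hu => ?_
  refine (lintegral_mono_set' (Filter.Eventually.of_forall hB)).trans' ?_
  refine setLIntegral_mono' hBm fun v hv => ?_
  have : h (v, u) = |localDisc P (box u v)| ^ p := Set.indicator_of_mem (hAB u hu v hv) _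
  rw [this]

/-- Sampling a grid cell by cell: the translates of the cell `[1/2, 1/2 + δ)^d` by multiples of `δ`
are disjoint subsets of `[1/2, 1]^d`. -/
lemma sum_lintegral_translate_le {d M : ℕ} {δ : ℝ} (hδ : 0 < δ) (hM : M * δ ≤ 1 / 2)
    (φ : (Fin d → ℝ) → ENNReal) (hφ : Measurable φ) :
    ∑ a : Fin d → Fin M, ∫⁻ v in Set.univ.pi fun _ => Set.Ico (1 / 2 : ℝ) (1 / 2 + δ),
        φ (v + fun j => δ * (a j : ℕ))
      ≤ ∫⁻ v in Set.Icc (fun _ : Fin d => (1 / 2 : ℝ)) 1, φ v := by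
  classical
  set Q : Set (Fin d → ℝ) := Set.univ.pi fun _ => Set.Ico (1 / 2 : ℝ) (1 / 2 + δ) with hQ
  have hQm : MeasurableSet Q := MeasurableSet.univ_pi fun _ => measurableSet_Ico
  set w : (Fin d → Fin M) → Fin d → ℝ := fun a j => δ * (a j : ℕ) with hw
  have e : ∀ a, ∫⁻ v in Q, φ (v + w a) = ∫⁻ v, Q.indicator 1 (v - w a) * φ v := by
    intro a
    rw [← lintegral_add_right_eq_self (fun v => Q.indicator 1 (v - w a) * φ v) (w a),
      ← lintegral_indicator hQm]
    refine lintegral_congr fun v => ?_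
    rw [add_sub_cancel_right]
    by_cases hv : v ∈ Q <;> simp [hv]
  have hm : ∀ a ∈ (univ : Finset (Fin d → Fin M)),
      Measurable fun v => Q.indicator 1 (v - w a) * φ v := fun a _ =>
    ((measurable_one.indicator hQm).comp (measurable_id.sub_const (w a))).mul hφ
  rw [sum_congr rfl fun a _ => e a, ← lintegral_finsetSum _ hm,
    ← lintegral_indicator measurableSet_Icc]
  refine lintegral_mono fun v => ?_
  rw [← sum_mul]
  have hmem : ∀ a : Fin d → Fin M, v - w a ∈ Q →
      ∀ j, 1 / 2 + δ * (a j : ℕ) ≤ v j ∧ v j < 1 / 2 + δ * ((a j : ℕ) + 1) := by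
    intro a ha j
    have := ha j (Set.mem_univ j)
    simp only [hw, Pi.sub_apply, Set.mem_Ico] at this
    constructor <;> linarith [this.1, this.2]
  by_cases hex : ∃ a, v - w a ∈ Q
  · obtain ⟨a, ha⟩ := hex
    have hv : v ∈ Set.Icc (fun _ : Fin d => (1 / 2 : ℝ)) 1 := by
      constructor
      · intro j
        have h1 := (hmem a ha j).1
        have : 0 ≤ δ * (a j : ℕ) := by positivity
        simp only
        linarith
      · intro j
        have h1 := (hmem a ha j).2
        have h2 : ((a j : ℕ) : ℝ) + 1 ≤ M := by exact_mod_cast (a j).2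
        have h3 : δ * (((a j : ℕ) : ℝ) + 1) ≤ δ * M := by gcongr
        simp only [Pi.one_apply]
        linarith
    have huniq : ∀ b, v - w b ∈ Q → b = a := by
      intro b hb
      have key : ∀ (x y : Fin d → Fin M), v - w x ∈ Q → v - w y ∈ Q → ∀ j, (x j : ℕ) ≤ y j := by
        intro x y hx hy j
        have h1 := (hmem x hx j).1
        have h2 := (hmem y hy j).2
        have h3 : δ * ((x j : ℕ) : ℝ) < δ * ((y j : ℕ) + 1) := by linarith
        have h4 : ((x j : ℕ) : ℝ) < (y j : ℕ) + 1 := lt_of_mul_lt_mul_left h3 hδ.le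
        have h5 : (x j : ℕ) < y j + 1 := by exact_mod_cast h4
        omega
      ext j
      exact le_antisymm (key b a hb ha j) (key a b ha hb j)
    rw [Set.indicator_of_mem hv, sum_eq_single a
      (fun b _ hba => Set.indicator_of_notMem (fun hb => hba (huniq b hb)) _) (by simp)]
    rw [Set.indicator_of_mem ha, Pi.one_apply, one_mul]
  · push Not at hex
    rw [sum_eq_zero fun a _ => Set.indicator_of_notMem (hex a) _, zero_mul]
    exact zero_le

end Transfer

/-! ### From sequences to grids with time as an extra coordinate. -/

section Sequences

lemma lt_add_mul_iff {x v δ : ℝ} (hδ : 0 < δ) (a : ℕ) :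
    x < v + δ * a ↔ (⌊(x - v) / δ⌋ + 1).toNat ≤ a := by
  rw [Int.toNat_le, Int.add_one_le_iff, Int.floor_lt, div_lt_iff₀ hδ, Int.cast_natCast]
  constructor <;> intro h <;> linarith

/-- Coordinate `0` is the number of terms: `k < a 0` reads `k + 1 ≤ a 0`, and the factor `N` of the
volume is the affine form `0 + 1 * a 0`. Strict inequalities in space are rounded to thresholds on
the grid, truncated at `0`. -/
lemma localDisc_box_eq_gridDisc {d K : ℕ} (S : ℕ → Fin d → ℝ) {u v : Fin d → ℝ} {δ : ℝ}
    (hδ : 0 < δ) (huv : u ≤ v) (a : Fin (d + 1) → Fin (2 ^ K)) :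
    localDisc (fun k : Fin (a 0) => S k) (box u (v + fun j => δ * (a j.succ : ℕ)))
      = gridDisc (fun k : Fin (2 ^ K) => ∏ j, if u j ≤ S k j then 1 else 0)
          (fun k => Fin.cons (k + 1) fun j => (⌊(S k j - v j) / δ⌋ + 1).toNat)
          (Fin.cons 0 fun j => v j - u j) (Fin.cons 1 fun _ => δ) a := by
  rw [localDisc_box_eq, gridDisc]
  congr 1
  · set Φ : ℕ → ℝ := fun k => ∏ j, if u j ≤ S k j ∧ S k j < v j + δ * (a j.succ : ℕ) then 1 else 0
      with hΦ
    have e : ∀ k : Fin (2 ^ K), (∏ j, if u j ≤ S k j then (1 : ℝ) else 0)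
        * geInd (Fin.cons (k + 1 : ℕ) fun j => (⌊(S k j - v j) / δ⌋ + 1).toNat) a
        = if (k : ℕ) < a 0 then Φ k else 0 := by
      intro k
      rw [geInd, Fin.prod_univ_succ, mul_left_comm, ← prod_mul_distrib]
      simp only [Fin.cons_zero, Fin.cons_succ, Nat.succ_le_iff, ite_mul, one_mul, zero_mul,
        ← lt_add_mul_iff hδ, hΦ]
      congr 1
      refine prod_congr rfl fun j _ => ?_
      split_ifs <;> first | rfl | tauto
    rw [sum_congr rfl fun k _ => e k,
      Fin.sum_univ_eq_sum_range (fun k => if k < (a 0 : ℕ) then Φ k else 0) (2 ^ K), ← sum_filter]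
    have hf : {k ∈ range (2 ^ K) | k < (a 0 : ℕ)} = range (a 0) := by
      ext k
      have := (a 0).2
      simp only [mem_filter, mem_range]
      omega
    rw [hf, ← Fin.sum_univ_eq_sum_range]
    rfl
  · rw [Fin.prod_univ_succ]
    simp only [Fin.cons_zero, Fin.cons_succ, zero_add, one_mul, Pi.add_apply]
    congr 1
    refine prod_congr rfl fun j _ => ?_
    have h1 : 0 ≤ δ * ((a j.succ : ℕ) : ℝ) := by positivity
    have := huv j
    rw [max_eq_left (by linarith)]
    ring

/-- For a suitable number of terms below `2 ^ K`, the discrepancy is at least of the order of the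
grid bound. -/
lemma exists_le_integral {d : ℕ} {p : ℝ} (hp : 0 ≤ p) {θ : ℝ} {K : ℕ}
    (hθ : ∀ (c : Fin (2 ^ K) → ℝ) (y : Fin (2 ^ K) → Fin (d + 1) → ℕ) (α β : Fin (d + 1) → ℝ),
      (∀ k, |c k| ≤ 1) → (∏ j, β j) * 2 ^ ((K + 1) * d) = 1 →
      θ * Fintype.card (Fin (d + 1) → Fin (2 ^ K))
        ≤ ∑ a : Fin (d + 1) → Fin (2 ^ K), |gridDisc c y α β a| ^ p)
    (S : ℕ → Fin d → ℝ) :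
    ∃ n < 2 ^ K, θ / 4 ^ d ≤ ∫ v in Set.Icc (0 : Fin d → ℝ) 1,
      ∫ u in {u ∈ Set.Icc (0 : Fin d → ℝ) 1 | u ≤ v},
        |localDisc (fun k : Fin n => S k) (box u v)| ^ p := by
  -- With this mesh, `2^K` cells per coordinate tile `[1/2, 1)`.
  set δ : ℝ := 1 / 2 ^ (K + 1) with hδ
  have hδ0 : 0 < δ := by positivity
  set I : ℕ → ℝ := fun n => ∫ v in Set.Icc (0 : Fin d → ℝ) 1,
      ∫ u in {u ∈ Set.Icc (0 : Fin d → ℝ) 1 | u ≤ v},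
        |localDisc (fun k : Fin n => S k) (box u v)| ^ p with hI
  obtain ⟨Ψ, hΨ⟩ : ∃ Ψ : ℕ → (Fin d → ℝ) → (Fin d → ℝ) → ENNReal, ∀ n u v, Ψ n u v =
      ENNReal.ofReal (|localDisc (fun k : Fin n => S k) (box u v)| ^ p) := ⟨_, fun _ _ _ => rfl⟩
  have hΨm : ∀ n, Measurable fun z : (Fin d → ℝ) × (Fin d → ℝ) => Ψ n z.2 z.1 := fun n => by
    simp only [hΨ]
    exact ((measurable_localDisc_box fun k : Fin n => S k).abs.pow_const p).ennreal_ofReal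
  have hΨm1 : ∀ n u, Measurable (Ψ n u) := fun n u =>
    (hΨm n).comp (measurable_prodMk_right (y := u))
  have hΨm2 : ∀ n, Measurable fun z : (Fin d → ℝ) × (Fin d → ℝ) => Ψ n z.1 z.2 := fun n =>
    (hΨm n).comp measurable_swap
  set U : Set (Fin d → ℝ) := Set.univ.pi fun _ => Set.Ico (0 : ℝ) (1 / 2) with hU
  set V : Set (Fin d → ℝ) := Set.Icc (fun _ => (1 / 2 : ℝ)) 1 with hV
  set Q : Set (Fin d → ℝ) := Set.univ.pi fun _ => Set.Ico (1 / 2 : ℝ) (1 / 2 + δ) with hQ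
  have hUm : MeasurableSet U := MeasurableSet.univ_pi fun _ => measurableSet_Ico
  have hQm : MeasurableSet Q := MeasurableSet.univ_pi fun _ => measurableSet_Ico
  have hUI : U ⊆ Set.Icc 0 1 := fun u hu => ⟨fun j => (hu j trivial).1, fun j =>
    (hu j trivial).2.le.trans (by norm_num)⟩
  have hVI : V ⊆ Set.Icc 0 1 := fun v hv => ⟨fun j => le_trans (by norm_num) (hv.1 j), hv.2⟩
  have hUV : ∀ u ∈ U, ∀ v ∈ V, u ≤ v := fun u hu v hv j => (hu j trivial).2.le.trans (hv.1 j)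
  have hUQ : ∀ u ∈ U, ∀ v ∈ Q, u ≤ v := fun u hu v hv j =>
    (hu j trivial).2.le.trans (hv j trivial).1
  have h1 : ∀ n, ∫⁻ u in U, ∑ a : Fin d → Fin (2 ^ K), ∫⁻ v in Q, Ψ n u (v + fun j => δ * (a j : ℕ))
      ≤ ENNReal.ofReal (I n) := fun n =>
    le_trans (lintegral_mono fun u => sum_lintegral_translate_le hδ0
        (by rw [hδ]; push_cast; field_simp; exact (pow_succ _ _).ge) (Ψ n u) (hΨm1 n u)) (by
      simp only [hΨ]
      exact lintegral_le_ofReal_extreme hp _ hUI hVI hUV hUm measurableSet_Icc)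
  have h2 : ∑ n : Fin (2 ^ K), ∫⁻ u in U, ∑ a : Fin d → Fin (2 ^ K),
      ∫⁻ v in Q, Ψ n u (v + fun j => δ * (a j : ℕ))
      = ∫⁻ u in U, ∫⁻ v in Q, ∑ a : Fin (d + 1) → Fin (2 ^ K),
        Ψ (a 0) u (v + fun j => δ * (a j.succ : ℕ)) := by
    have hm : ∀ (n : ℕ) (w : Fin d → ℝ), Measurable fun u => ∫⁻ v in Q, Ψ n u (v + w) :=
      fun n w => Measurable.lintegral_prod_right'
        (f := fun z : (Fin d → ℝ) × (Fin d → ℝ) => Ψ n z.1 (z.2 + w))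
        ((hΨm2 n).comp (measurable_fst.prodMk (measurable_snd.add_const w)))
    rw [← lintegral_finsetSum _ fun n _ => Finset.measurable_sum _ fun a _ => hm _ _]
    refine lintegral_congr fun u => ?_
    have hm1 : ∀ a ∈ (univ : Finset (Fin (d + 1) → Fin (2 ^ K))),
        Measurable fun v : Fin d → ℝ => Ψ (a 0) u (v + fun j => δ * (a j.succ : ℕ)) := fun a _ =>
      (hΨm1 _ u).comp (measurable_id.add_const _)
    rw [lintegral_finsetSum _ hm1,
      ← (Fin.consEquiv fun _ : Fin (d + 1) => Fin (2 ^ K)).sum_comp, Fintype.sum_prod_type]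
    rfl
  have h3 : ENNReal.ofReal (2 ^ K * (θ / 4 ^ d)) ≤ ∫⁻ u in U, ∫⁻ v in Q,
      ∑ a : Fin (d + 1) → Fin (2 ^ K), Ψ (a 0) u (v + fun j => δ * (a j.succ : ℕ)) := by
    set X : ℝ := (Fintype.card (Fin (d + 1) → Fin (2 ^ K)) : ℝ) with hX
    have hlow : ∀ u ∈ U, ∀ v ∈ Q, ENNReal.ofReal (θ * X) ≤ ∑ a : Fin (d + 1) → Fin (2 ^ K),
        Ψ (a 0) u (v + fun j => δ * (a j.succ : ℕ)) := by
      intro u hu v hv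
      simp only [hΨ, localDisc_box_eq_gridDisc S hδ0 (hUQ u hu v hv)]
      rw [← ENNReal.ofReal_sum_of_nonneg fun a _ => by positivity]
      refine ENNReal.ofReal_le_ofReal (hθ _ _ _ _ (fun k => ?_) ?_)
      · rw [abs_prod]
        exact prod_le_one (fun j _ => abs_nonneg _) fun j _ => by split_ifs <;> simp
      · rw [Fin.prod_univ_succ]
        simp only [Fin.cons_zero, Fin.cons_succ, one_mul, prod_const, card_univ, Fintype.card_fin]
        rw [pow_mul, hδ, one_div, inv_pow, inv_mul_cancel₀ (by positivity)]
    have hvolU : volume U = ENNReal.ofReal ((1 / 2) ^ d) := by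
      rw [hU, Real.volume_pi_Ico, ENNReal.ofReal_pow (by norm_num)]
      simp
    have hvolQ : volume Q = ENNReal.ofReal (δ ^ d) := by
      rw [hQ, Real.volume_pi_Ico, ENNReal.ofReal_pow hδ0.le]
      simp
    -- Of the `2^(K(d+1))` grid points, `2^K` count the values of `n`; the rest times `vol Q * vol
    -- U` is `2^(Kd) * 2^(-(K+1)d) * 2^(-d) = 4^(-d)`.
    calc ENNReal.ofReal (2 ^ K * (θ / 4 ^ d))
        = ENNReal.ofReal (θ * X) * volume Q * volume U := by
          rw [hvolU, hvolQ, ← ENNReal.ofReal_mul' (by positivity),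
            ← ENNReal.ofReal_mul' (by positivity)]
          congr 1
          have hX' : X = 2 ^ K * (2 ^ K) ^ d := by rw [hX]; simp; ring
          have h4 : (4 : ℝ) ^ d = 2 ^ d * 2 ^ d := by rw [← mul_pow]; norm_num
          rw [hX', hδ, h4, one_div_pow, one_div_pow, pow_succ, mul_pow]
          field_simp
      _ = ∫⁻ u in U, ∫⁻ v in Q, ENNReal.ofReal (θ * X) := by
          simp only [setLIntegral_const]
      _ ≤ _ := setLIntegral_mono' hUm fun u hu => setLIntegral_mono' hQm fun v hv => hlow u hu v hv
  have hI0 : ∀ n, 0 ≤ I n := fun n =>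
    integral_nonneg fun v => integral_nonneg fun u => by positivity
  have h4 : ENNReal.ofReal (2 ^ K * (θ / 4 ^ d)) ≤ ENNReal.ofReal (∑ n : Fin (2 ^ K), I n) := by
    rw [ENNReal.ofReal_sum_of_nonneg fun (n : Fin (2 ^ K)) _ => hI0 n]
    exact (h3.trans h2.ge).trans (sum_le_sum fun n _ => h1 n)
  rw [ENNReal.ofReal_le_ofReal_iff (sum_nonneg fun (n : Fin (2 ^ K)) _ => hI0 n)] at h4
  have h5 : ∑ n : Fin (2 ^ K), θ / 4 ^ d ≤ ∑ n : Fin (2 ^ K), I n := by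
    refine le_trans (le_of_eq ?_) h4
    simp
  obtain ⟨n, -, hn⟩ := exists_le_of_sum_le (univ_nonempty_iff.2 ⟨⟨0, by positivity⟩⟩) h5
  exact ⟨n, n.2, hn⟩

theorem infinite_of_gridLowerBound {d : ℕ} (hd : 1 ≤ d) {p : ℝ} (hp : 0 < p)
    (h : GridLowerBound d p) : ∃ α : ℝ, 0 < α ∧ ∀ S : ℕ → Fin d → ℝ,
      {N : ℕ | α * Real.log N ^ ((d : ℝ) / 2) ≤ seqExtremeLp p S N}.Infinite := by
  obtain ⟨γ, hγ, J₀, hJ₀⟩ := h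
  set κ : ℝ := (γ / 4 ^ d) ^ (1 / p) with hκ
  have hκ0 : 0 < κ := by positivity
  have hd0 : (0 : ℝ) < d := by exact_mod_cast hd
  have key : ∀ S : ℕ → Fin d → ℝ, ∀ J ≥ J₀, ∃ n < 2 ^ (d * (J + 2)),
      κ * (J : ℝ) ^ ((d : ℝ) / 2) ≤ seqExtremeLp p S n := by
    intro S J hJ
    set R : ℝ := (J : ℝ) ^ ((d : ℝ) / 2) with hR
    have hR0 : 0 ≤ R := by positivity
    obtain ⟨n, hn, hle⟩ := exists_le_integral (θ := γ * R ^ p) hp.le (fun c y α β hc hβ => by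
      have := hJ₀ J hJ _ rfl c y α β hc hβ
      linarith) S
    refine ⟨n, hn, ?_⟩
    calc κ * R = (γ * R ^ p / 4 ^ d) ^ (1 / p) := by
          rw [mul_div_right_comm, Real.mul_rpow (by positivity) (by positivity),
            ← Real.rpow_mul hR0, mul_one_div_cancel hp.ne', Real.rpow_one]
      _ ≤ seqExtremeLp p S n := Real.rpow_le_rpow (by positivity) hle (by positivity)
  -- The factor `3 * d` comes from `log n ≤ d (J + 2) ≤ 3 d J`. If only finitely many `N` qualified,
  -- their discrepancies would be bounded; yet for large `J` the index found has discrepancy above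
  -- that bound and itself qualifies. No lower bound on `n` is needed.
  refine ⟨κ / (3 * d) ^ ((d : ℝ) / 2), by positivity, fun S hfin => ?_⟩
  obtain ⟨B, hB⟩ := (hfin.image (seqExtremeLp p S)).bddAbove
  have hlim : Filter.Tendsto (fun J : ℕ => κ * (J : ℝ) ^ ((d : ℝ) / 2)) Filter.atTop Filter.atTop :=
    ((tendsto_rpow_atTop (by positivity)).comp tendsto_natCast_atTop_atTop).const_mul_atTop hκ0
  obtain ⟨J, hJB, hJ⟩ := ((hlim.eventually_gt_atTop B).and
    (Filter.eventually_ge_atTop (max J₀ 1))).exists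
  obtain ⟨n, hn, hle⟩ := key S J ((le_max_left _ _).trans hJ)
  have hJ1 : (1 : ℝ) ≤ J := by exact_mod_cast (le_max_right _ _).trans hJ
  have hlog : Real.log n ≤ 3 * d * J := by
    rcases Nat.eq_zero_or_pos n with rfl | hn0
    · simpa using (by positivity : 0 ≤ 3 * (d : ℝ) * J)
    · calc Real.log n ≤ Real.log (2 ^ (d * (J + 2))) :=
            Real.log_le_log (by exact_mod_cast hn0) (by exact_mod_cast hn.le)
        _ = d * (J + 2) * Real.log 2 := by rw [Real.log_pow]; push_cast; ring
        _ ≤ d * (J + 2) * 1 := by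
            gcongr
            linarith [Real.log_two_lt_d9]
        _ ≤ 3 * d * J := by nlinarith
  have hmem : n ∈ {N : ℕ | κ / (3 * d) ^ ((d : ℝ) / 2) * Real.log N ^ ((d : ℝ) / 2)
      ≤ seqExtremeLp p S N} := by
    refine le_trans ?_ hle
    calc κ / (3 * d) ^ ((d : ℝ) / 2) * Real.log n ^ ((d : ℝ) / 2)
        ≤ κ / (3 * d) ^ ((d : ℝ) / 2) * (3 * d * J) ^ ((d : ℝ) / 2) := by
          gcongr
      _ = κ * (J : ℝ) ^ ((d : ℝ) / 2) := by
          rw [Real.mul_rpow (x := 3 * (d : ℝ)) (by positivity) (by positivity), ← mul_assoc,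
            div_mul_cancel₀ _ (by positivity)]
  have := hB ⟨n, hmem, rfl⟩
  linarith

end Sequences

end ExtremeDiscrepancy

theorem theorem1 :
    (∀ d : ℕ, 1 ≤ d → ∀ p : ℝ, 1 < p →
      ∃ α : ℝ, 0 < α ∧
        ∀ S : ℕ → Fin d → ℝ, (∀ k j, S k j ∈ Set.Ico (0 : ℝ) 1) →
          {N : ℕ | α * Real.log N ^ ((d : ℝ) / 2)
            ≤ ExtremeDiscrepancy.seqExtremeLp p S N}.Infinite) ∧
    (∃ α : ℝ, 0 < α ∧
      ∀ S : ℕ → Fin 1 → ℝ, (∀ k j, S k j ∈ Set.Ico (0 : ℝ) 1) →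
        {N : ℕ | α * Real.log N ^ ((1 : ℝ) / 2)
          ≤ ExtremeDiscrepancy.seqExtremeLp 1 S N}.Infinite) := by
  constructor
  · intro d hd p hp
    obtain ⟨α, hα, h⟩ := ExtremeDiscrepancy.infinite_of_gridLowerBound hd (zero_lt_one.trans hp)
      (ExtremeDiscrepancy.gridLowerBound_of_one_lt hd hp)
    exact ⟨α, hα, fun S _ => h S⟩
  · obtain ⟨α, hα, h⟩ := ExtremeDiscrepancy.infinite_of_gridLowerBound le_rfl zero_lt_one
      ExtremeDiscrepancy.gridLowerBound_one_one
    exact ⟨α, hα, fun S _ => by simpa using h S⟩
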